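/- A partition of a non-negative integer $n$ is a non-increasing sequence of positive integers with sum $n$. For a sequence $a(n)$ ($n\ge 0$) of non-negative integers, an integer base $k\ge 2$, and an integer $d\ge 1$ (identified with the string of its base-$k$ digits), put $$B(d,x,k;a(n))=\frac{\#\{n\le x:\ \text{the first digits of } a(n)\text{ in base }k\text{ are the string }d\}}{x},$$ where the number $0$ has no first digits. The sequence $a(n)$ is called Benford if $\lim_{x\to\infty}B(d,x,k;a(n))=\log_k(d+1)-\log_k(d)$ for all integers $k\ge 2$ and $d\ge 1$. For integers $\delta\ge 2$ and $0<g<\lfloor(\delta+1)/2\rfloor$ let $r_{g,\delta}(n)$ be the number of partitions of $n$ into parts congruent to $\pm g \pmod\delta$. Then $r_{g,\delta}(n)\ne 0$ for infinitely many $n$, and the nonzero values of $r_{g,\delta}(n)$, listed in order of increasing $n$, form a Benford sequence. If $\gcd(g,\delta)=1$, then the sequence $r_{g,\delta}(n)$ itself is Benford. This includes the Rogers–Ramanujan partition functions: for $a=0,1$, as formal power series in $q$ (with coefficientwise convergence), $$\sum_{n=0}^{\infty}\frac{q^{n^2+an}}{(q;q)_n}=\prod_{n=0}^{\infty}\frac{1}{(1-q^{5n+a+1})(1-q^{5n+4-a})}=\sum_{n=0}^{\infty}r_{a+1,5}(n)\,q^n,$$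 where $(b;q)_n=\prod_{i=0}^{n-1}(1-bq^i)$. -/

import Mathlib

open scoped PowerSeries.WithPiTopology

/-- `HasLeadingDigits k d a`: the base `k` expansion of `a` begins with the base `k` expansion
of `d`. (`Nat.digits` lists digits from the least significant one, so that leading digits are
a suffix.) A string of leading digits starts with a nonzero digit, so it is
the expansion of a unique positive integer `d`; the number `0` has no leading digits. -/
def HasLeadingDigits (k d a : ℕ) : Prop :=
  Nat.digits k d <:+ Nat.digits k a

/-- The quantity `B(d, x, k; a)`: the number of `n ≤ x` such that the first digits of `a n` in
base `k` form the string `d`, divided by `x`. -/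
noncomputable def benfordFreq (d : ℕ) (x : ℝ) (k : ℕ) (a : ℕ → ℕ) : ℝ :=
  ({n : ℕ | (n : ℝ) ≤ x ∧ HasLeadingDigits k d (a n)}.ncard : ℝ) / x

/-- A sequence is Benford if, in every base `k ≥ 2`, every string `d` of leading digits occurs
with limiting frequency `log_k (d + 1) - log_k d`. -/
def IsBenford (a : ℕ → ℕ) : Prop :=
  ∀ k : ℕ, 2 ≤ k → ∀ d : ℕ, 1 ≤ d →
    Filter.Tendsto (fun x : ℝ => benfordFreq d x k a) Filter.atTop
      (nhds (Real.logb k ((d : ℝ) + 1) - Real.logb k d))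

/-- The nonzero terms of the sequence `a`, listed in order of their index (used for sequences
with infinitely many nonzero terms). -/
noncomputable def nonzeroTerms (a : ℕ → ℕ) (m : ℕ) : ℕ :=
  a (Nat.nth (fun n => a n ≠ 0) m)

/-- `partitionCount g δ n` is the number `r_{g,δ}(n)` of partitions of `n` all of whose parts
are congruent to `g` or to `-g` modulo `δ`. -/
def partitionCount (g δ n : ℕ) : ℕ :=
  (Nat.Partition.restricted n
    fun i => (i : ℤ) ≡ (g : ℤ) [ZMOD (δ : ℤ)] ∨ (i : ℤ) ≡ -(g : ℤ) [ZMOD (δ : ℤ)]).card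

/-- The `q`-Pochhammer symbol `(a; q)_n = ∏_{0 ≤ i < n} (1 - a q ^ i)`. -/
def qPochhammer {R : Type*} [CommRing R] (a q : R) (n : ℕ) : R :=
  ∏ i ∈ Finset.range n, (1 - a * q ^ i)

/-! Benford part. Dividing all parts by `gcd(g, δ)` reduces to the coprime case. There log r(n) is,
around each large n, close to an affine function of slope α, where α is small and 1/α = o(n). On a
window of length K/α the logarithm climbs slowly and almost linearly through about K / log k periods
of length log k, so it spends a proportional share of its time in each interval modulo log k. Tiling
[0, x] by such windows gives equidistribution modulo log k, which is Benford's law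
(`isBenford_of_locallyAffine`). No asymptotic formula for r(n) is needed.

Local affinity comes from a local limit theorem. Let F(q) = ∑ r(n) q^n = exp(∑ q^(km)/k), summed
over k ≥ 1 and admissible parts m. The numbers r(n) e^(-αn) / F(e^(-α)) form a compound Poisson law,
with intensity e^(-αkm)/k at the jump km. Choose α so that its mean is N (`exists_saddle`). The
second and third moments of the intensity are O(α^-3) and O(α^-4), and coprimality makes
|F(e^(-α+iθ))| much smaller than F(e^(-α)) away from θ = 0 (`exists_decay_le`). Fourier inversion
shows that the law is flat near N on scales below α^(-3/2), which is far more than K/α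
(`local_limit`). Undoing the tilt e^(-αn) leaves log r(n) affine of slope α
(`locallyAffine_log_partsCount`). The parameter is written α = a^2, so that a^3 is the natural unit
for θ.

Rogers–Ramanujan part. Two steps along the Bailey chain from the unit Bailey pair (`bailey_step`),
then n → ∞, turn the sum side into a theta series. The Jacobi triple product, proved first in finite
form (`finite_triple_product`), evaluates that series as a product. -/

namespace RogersRamanujan

open Finset

/-! ### Finite q-series identities: Bailey chain and triple product -/

section Finite

variable {R : Type*} [CommRing R] [IsDomain R] {q : R} {e : ℕ → R}

/-- A special case of the `q`-Vandermonde sum, where `e n` plays the role of `1 / (q; q)_n`. -/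
theorem sum_vandermonde (hq : ∀ n, 1 - q ^ (n + 1) ≠ 0) (h0 : e 0 = 1)
    (he : ∀ n, e n = (1 - q ^ (n + 1)) * e (n + 1)) (A B : ℕ) :
    ∑ j ∈ range (A + 1), q ^ (j * (j + B)) * (e j * e (A - j) * e (j + B)) = e A * e (A + B) := by
  induction A generalizing B with
  | zero => simp [h0]
  | succ A ih =>
    apply mul_left_cancel₀ (hq A)
    -- Split 1 - q^(A+1) = (1 - q^(A+1-j)) + q^(A+1-j) (1 - q^j). The first term lowers the index of
    -- `e (A + 1 - j)`; the second lowers that of `e j`, and shifting j then replaces B by B + 1.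
    have key : (1 - q ^ (A + 1)) *
        ∑ j ∈ range (A + 1 + 1), q ^ (j * (j + B)) * (e j * e (A + 1 - j) * e (j + B)) =
        ∑ j ∈ range (A + 1), q ^ (j * (j + B)) * (e j * e (A - j) * e (j + B)) +
        q ^ (A + B + 1) * ∑ j ∈ range (A + 1),
          q ^ (j * (j + (B + 1))) * (e j * e (A - j) * e (j + (B + 1))) := by
      have h1 : ∀ j ∈ range (A + 1 + 1),
          (1 - q ^ (A + 1)) * (q ^ (j * (j + B)) * (e j * e (A + 1 - j) * e (j + B))) =
          (1 - q ^ (A + 1 - j)) * (q ^ (j * (j + B)) * (e j * e (A + 1 - j) * e (j + B))) +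
          q ^ (A + 1 - j) * (1 - q ^ j) *
            (q ^ (j * (j + B)) * (e j * e (A + 1 - j) * e (j + B))) := by
        intro j hj
        have : q ^ (A + 1) = q ^ (A + 1 - j) * q ^ j := by
          rw [← pow_add]; congr 1; have := mem_range.1 hj; omega
        rw [this]; ring
      rw [mul_sum, sum_congr rfl h1, sum_add_distrib]
      congr 1
      · rw [sum_range_succ]
        simp only [Nat.sub_self, pow_zero, sub_self, zero_mul, add_zero]
        refine sum_congr rfl fun j hj => ?_
        have hj' := mem_range.1 hj
        have : A + 1 - j = A - j + 1 := by omega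
        rw [this, he (A - j)]; ring
      · rw [sum_range_succ']
        simp only [pow_zero, sub_self, mul_zero, zero_mul, add_zero]
        rw [mul_sum]
        refine sum_congr rfl fun j hj => ?_
        have hj' := mem_range.1 hj
        have h2 : A + 1 - (j + 1) = A - j := by omega
        have h3 : j + 1 + B = j + (B + 1) := by ring
        have h4 : q ^ (A - j) * q ^ ((j + 1) * (j + (B + 1))) =
            q ^ (A + B + 1) * q ^ (j * (j + (B + 1))) := by
          rw [← pow_add, ← pow_add]; congr 1
          obtain ⟨k, rfl⟩ := Nat.exists_eq_add_of_le (Nat.lt_succ_iff.1 hj')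
          rw [Nat.add_sub_cancel_left]; ring
        rw [h2, h3, he j]
        linear_combination (1 - q ^ (j + 1)) * e (j + 1) * e (A - j) * e (j + (B + 1)) * h4
    rw [key, ih, ih, he A, ← add_assoc, he (A + B)]
    have : A + 1 + B = A + B + 1 := by ring
    rw [this]; ring

/-- One step along a Bailey chain. -/
theorem bailey_step (hq : ∀ n, 1 - q ^ (n + 1) ≠ 0) (h0 : e 0 = 1)
    (he : ∀ n, e n = (1 - q ^ (n + 1)) * e (n + 1)) (a : ℕ) {α β : ℕ → R}
    (h : ∀ n, β n = ∑ r ∈ range (n + 1), α r * (e (n - r) * e (n + r + a))) (n : ℕ) :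
    ∑ s ∈ range (n + 1), q ^ (s ^ 2 + a * s) * β s * e (n - s) =
      ∑ r ∈ range (n + 1), q ^ (r ^ 2 + a * r) * α r * (e (n - r) * e (n + r + a)) := by
  have h1 : ∀ s ∈ range (n + 1), q ^ (s ^ 2 + a * s) * β s * e (n - s) =
      ∑ r ∈ range (s + 1), q ^ (s ^ 2 + a * s) * e (n - s) *
        (α r * (e (s - r) * e (s + r + a))) := by
    intro s _
    rw [h s, mul_right_comm, mul_sum]
  -- After interchanging the sums and putting s = r + j, the inner sum is `sum_vandermonde` with A =
  -- n - r and B = 2r + a.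
  rw [sum_congr rfl h1,
    sum_comm' (t' := range (n + 1)) (s' := fun r => Ico r (n + 1))
      (by intro x y; simp only [mem_range, mem_Ico]; omega)]
  refine sum_congr rfl fun r hr => ?_
  have hr' := Nat.lt_succ_iff.1 (mem_range.1 hr)
  obtain ⟨A, rfl⟩ := Nat.exists_eq_add_of_le hr'
  have h2 := sum_vandermonde hq h0 he A (2 * r + a)
  rw [sum_Ico_eq_sum_range, show r + A + 1 - r = A + 1 by omega, Nat.add_sub_cancel_left,
    show r + A + r + a = A + (2 * r + a) by ring, ← h2, mul_sum]
  refine sum_congr rfl fun j hj => ?_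
  have hj' := Nat.lt_succ_iff.1 (mem_range.1 hj)
  rw [show r + A - (r + j) = A - j by omega, Nat.add_sub_cancel_left,
    show r + j + r + a = j + (2 * r + a) by ring,
    show (r + j) ^ 2 + a * (r + j) = (r ^ 2 + a * r) + j * (j + (2 * r + a)) by ring, pow_add]
  ring

/-- The terms of the symmetrised theta series. -/
def thetaCoeff (x y : R) (r : ℕ) : R :=
  if r = 0 then 1 else (-1) ^ r * (x * y) ^ (r.choose 2) * (x ^ r + y ^ r)

omit [IsDomain R] in
theorem thetaCoeff_succ (x y : R) (r : ℕ) : thetaCoeff x y (r + 1) =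
    (-1) ^ (r + 1) * (x * y) ^ ((r + 1).choose 2) * (x ^ (r + 1) + y ^ (r + 1)) := by
  simp [thetaCoeff]

/-- A finite form of the Jacobi triple product identity. -/
theorem finite_triple_product {x y : R} (hxy : x * y = q) (hq : ∀ n, 1 - q ^ (n + 1) ≠ 0)
    (h0 : e 0 = 1) (he : ∀ n, e n = (1 - q ^ (n + 1)) * e (n + 1)) (n : ℕ) :
    ∑ r ∈ range (n + 1), thetaCoeff x y r * (e (n - r) * e (n + r)) =
      e (2 * n) * ∏ i ∈ range n, ((1 - x * q ^ i) * (1 - y * q ^ i)) := by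
  induction n with
  | zero => simp [thetaCoeff, h0]
  | succ n ih =>
    apply mul_left_cancel₀ (mul_ne_zero (hq (2 * n)) (hq (2 * n + 1)))
    have hR : (1 - q ^ (2 * n + 1)) * (1 - q ^ (2 * n + 1 + 1)) *
        (e (2 * (n + 1)) * ∏ i ∈ range (n + 1), ((1 - x * q ^ i) * (1 - y * q ^ i))) =
        (1 - x * q ^ n) * (1 - y * q ^ n) *
          (e (2 * n) * ∏ i ∈ range n, ((1 - x * q ^ i) * (1 - y * q ^ i))) := by
      rw [prod_range_succ, he (2 * n), he (2 * n + 1), show 2 * (n + 1) = 2 * n + 1 + 1 by ring]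
      ring
    rw [hR, ← ih]
    -- `E` extends e(m - r) by 0 beyond r = m, where truncated subtraction would give e(0). `g m r`
    -- is then the coefficient of x^r + y^r for r ≥ 1.
    set E : ℕ → ℕ → R := fun m r => if r ≤ m then e (m - r) else 0 with hE
    set g : ℕ → ℕ → R := fun m r => (-1) ^ r * q ^ (r.choose 2) * (E m r * e (m + r)) with hg
    have hg_zero : ∀ m r, m < r → g m r = 0 := by
      intro m r hr; simp [hg, hE, Nat.not_le.2 hr]
    have hsum : ∀ m, ∑ r ∈ range (m + 1), thetaCoeff x y r * (e (m - r) * e (m + r)) =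
        g m 0 + ∑ r ∈ range m, g m (r + 1) * (x ^ (r + 1) + y ^ (r + 1)) := by
      intro m
      rw [sum_range_succ', add_comm]
      congr 1
      · simp [thetaCoeff, hg, hE]
      · refine sum_congr rfl fun r hr => ?_
        have : r + 1 ≤ m := mem_range.1 hr
        simp only [thetaCoeff_succ, hg, hE, this, if_true, hxy]
        ring
    rw [hsum, hsum]
    have hE1 : ∀ r, r ≤ n + 1 → E n r = (1 - q ^ (n + 1 - r)) * E (n + 1) r := by
      intro r hr
      rcases hr.eq_or_lt with rfl | hr'
      · simp [hE]
      · have h1 : r ≤ n := by omega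
        simp only [hE, h1, hr, if_true]
        rw [show n + 1 - r = n - r + 1 by omega, ← he]
    have hc0 : (1 - q ^ (2 * n + 1)) * (1 - q ^ (2 * n + 1 + 1)) * g (n + 1) 0 =
        (1 + q ^ (2 * n + 1)) * g n 0 - 2 * q ^ (n + 1) * g n 1 := by
      have h1 := hE1 0 (by omega)
      have h2 : E n 1 = (1 - q ^ n) * E n 0 := by
        rcases n with _ | n
        · simp [hE]
        · simp only [hE, Nat.le_add_left, if_true, Nat.sub_zero]
          rw [Nat.add_sub_cancel, he n]
      simp only [hg, Nat.choose_zero_succ, pow_zero, Nat.add_zero, pow_one, one_mul]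
      rw [h2, h1, he n, show Nat.choose 1 2 = 0 from rfl]
      simp only [Nat.sub_zero]
      ring
    -- This recursion mirrors multiplication by (1 - x q^n)(1 - y q^n) = 1 + q^(2n+1) - q^n (x + y),
    -- with x + y acting on x^r + y^r as in `hp`. The constant term `hc0` is separate, because
    -- `thetaCoeff` has 1 at r = 0 and not x^0 + y^0 = 2.
    have hcs : ∀ r ∈ range (n + 1),
        (1 - q ^ (2 * n + 1)) * (1 - q ^ (2 * n + 1 + 1)) * g (n + 1) (r + 1) =
        (1 + q ^ (2 * n + 1)) * g n (r + 1) - q ^ n * (g n r + q * g n (r + 2)) := by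
      intro r hr
      have hr' := Nat.lt_succ_iff.1 (mem_range.1 hr)
      obtain ⟨ρ, rfl⟩ := Nat.exists_eq_add_of_le hr'
      have h1 := hE1 (r + 1) (by omega)
      have h2 : E (r + ρ) r = E (r + ρ + 1) (r + 1) := by
        simp [hE]
      have h3 : q * q ^ r * E (r + ρ) (r + 2) =
          (q * q ^ r - q ^ (r + ρ)) * (1 - q ^ ρ) * E (r + ρ + 1) (r + 1) := by
        rcases ρ with _ | ρ
        · simp [hE]
        · have h4 := hE1 (r + 2) (by omega)
          have h5 : E (r + (ρ + 1) + 1) (r + 2) =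
              (1 - q ^ (ρ + 1)) * E (r + (ρ + 1) + 1) (r + 1) := by
            have a1 : r + 2 ≤ r + (ρ + 1) + 1 := by omega
            have a2 : r + 1 ≤ r + (ρ + 1) + 1 := by omega
            simp only [hE, a1, a2, if_true]
            rw [show r + (ρ + 1) + 1 - (r + 2) = ρ by omega,
              show r + (ρ + 1) + 1 - (r + 1) = ρ + 1 by omega, ← he]
          rw [h4, h5, show r + (ρ + 1) + 1 - (r + 2) = ρ by omega]
          ring
      rw [show r + ρ + 1 - (r + 1) = ρ by omega] at h1
      have c1 : (r + 1).choose 2 = r + r.choose 2 := by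
        rw [Nat.choose_succ_succ' r 1, Nat.choose_one_right]
      have c2 : (r + 2).choose 2 = r + 1 + (r + r.choose 2) := by
        rw [Nat.choose_succ_succ' (r + 1) 1, Nat.choose_one_right, c1]
      have e1 := he (r + ρ + r)
      have e2 := he (r + ρ + r + 1)
      simp only [hg]
      rw [c1, c2, h2, h1, show r + ρ + (r + 1) = r + ρ + r + 1 by ring,
        show r + ρ + (r + 2) = r + ρ + r + 1 + 1 by ring,
        show r + ρ + 1 + (r + 1) = r + ρ + r + 1 + 1 by ring, e1, e2]
      linear_combination (-1) ^ r * q ^ r.choose 2 * q ^ (r + ρ) * q * q ^ r *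
        e (r + ρ + r + 1 + 1) * h3
    have hp : ∀ r, (x + y) * (x ^ (r + 1) + y ^ (r + 1)) =
        (x ^ (r + 2) + y ^ (r + 2)) + q * (x ^ r + y ^ r) := by
      intro r; rw [← hxy]; ring
    have hL : (1 - q ^ (2 * n + 1)) * (1 - q ^ (2 * n + 1 + 1)) *
        (g (n + 1) 0 + ∑ r ∈ range (n + 1), g (n + 1) (r + 1) * (x ^ (r + 1) + y ^ (r + 1))) =
        ((1 + q ^ (2 * n + 1)) * g n 0 - 2 * q ^ (n + 1) * g n 1) +
        ∑ r ∈ range (n + 1), ((1 + q ^ (2 * n + 1)) * g n (r + 1) -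
          q ^ n * (g n r + q * g n (r + 2))) * (x ^ (r + 1) + y ^ (r + 1)) := by
      rw [mul_add, hc0, mul_sum]
      congr 1
      refine sum_congr rfl fun r hr => ?_
      rw [← mul_assoc, hcs r hr]
    rw [hL]
    have hext : ∑ r ∈ range n, g n (r + 1) * (x ^ (r + 1) + y ^ (r + 1)) =
        ∑ r ∈ range (n + 1), g n (r + 1) * (x ^ (r + 1) + y ^ (r + 1)) := by
      rw [sum_range_succ, hg_zero n (n + 1) (by omega)]; ring
    have s1 : (x + y) * ∑ r ∈ range (n + 1), g n (r + 1) * (x ^ (r + 1) + y ^ (r + 1)) =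
        ∑ r ∈ range (n + 1), g n (r + 1) * (x ^ (r + 2) + y ^ (r + 2)) +
        q * ∑ r ∈ range (n + 1), g n (r + 1) * (x ^ r + y ^ r) := by
      rw [mul_sum, mul_sum, ← sum_add_distrib]
      refine sum_congr rfl fun r _ => ?_
      linear_combination g n (r + 1) * hp r
    have s2 : ∑ r ∈ range (n + 1), g n r * (x ^ (r + 1) + y ^ (r + 1)) =
        ∑ r ∈ range (n + 1), g n (r + 1) * (x ^ (r + 2) + y ^ (r + 2)) + g n 0 * (x + y) := by
      rw [sum_range_succ', sum_range_succ _ n, hg_zero n (n + 1) (by omega)]; ring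
    have s3 : ∑ r ∈ range (n + 1), g n (r + 1) * (x ^ r + y ^ r) =
        ∑ r ∈ range (n + 1), g n (r + 2) * (x ^ (r + 1) + y ^ (r + 1)) + 2 * g n 1 := by
      rw [sum_range_succ', sum_range_succ _ n, hg_zero n (n + 2) (by omega)]
      simp only [pow_zero]; ring
    have s4 : ∑ r ∈ range (n + 1), ((1 + q ^ (2 * n + 1)) * g n (r + 1) -
          q ^ n * (g n r + q * g n (r + 2))) * (x ^ (r + 1) + y ^ (r + 1)) =
        (1 + q ^ (2 * n + 1)) * ∑ r ∈ range (n + 1), g n (r + 1) * (x ^ (r + 1) + y ^ (r + 1)) -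
        q ^ n * ∑ r ∈ range (n + 1), g n r * (x ^ (r + 1) + y ^ (r + 1)) -
        q ^ n * q * ∑ r ∈ range (n + 1), g n (r + 2) * (x ^ (r + 1) + y ^ (r + 1)) := by
      rw [mul_sum, mul_sum, mul_sum, ← sum_sub_distrib, ← sum_sub_distrib]
      refine sum_congr rfl fun r _ => ?_
      ring
    have hpr : (1 - x * q ^ n) * (1 - y * q ^ n) = 1 + q ^ (2 * n + 1) - q ^ n * (x + y) := by
      rw [pow_succ, ← hxy]; ring
    rw [s4, s2, hext, hpr]
    linear_combination q ^ n * s1 + q ^ (n + 1) * s3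

/-- The unit Bailey pair relative to `q ^ a` for `a = 0`. -/
theorem unit_pair_zero (hq : ∀ n, 1 - q ^ (n + 1) ≠ 0)
    (h0 : e 0 = 1) (he : ∀ n, e n = (1 - q ^ (n + 1)) * e (n + 1)) (n : ℕ) :
    (if n = 0 then 1 else 0) = ∑ r ∈ range (n + 1), thetaCoeff 1 q r * (e (n - r) * e (n + r)) := by
  rw [finite_triple_product (one_mul q) hq h0 he]
  rcases n with _ | n
  · simp [h0]
  -- With x = 1 the factor at i = 0 vanishes.
  · rw [prod_range_succ']; simp

omit [IsDomain R] in
/-- Changing the parameter of a Bailey pair from `1` to `q`. -/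
theorem sum_shift (he : ∀ n, e n = (1 - q ^ (n + 1)) * e (n + 1)) {c d : ℕ → R}
    (hc0 : c 0 = d 0) (hc : ∀ r, c (r + 1) = d (r + 1) - q ^ (2 * r + 1) * d r) (n : ℕ) :
    ∑ r ∈ range (n + 1), c r * (e (n - r) * e (n + r)) =
      ∑ r ∈ range (n + 1), d r * (1 - q ^ (2 * r + 1)) * (e (n - r) * e (n + r + 1)) := by
  -- Uses 1 - q^(2r+1) = (1 - q^(n+r+1)) - q^(2r+1) (1 - q^(n-r)): the first bracket lowers `e (n +
  -- r + 1)`, the second lowers `e (n - r)` and is absorbed by an index shift.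
  have h1 : ∀ r ∈ range (n + 1), d r * (1 - q ^ (2 * r + 1)) * (e (n - r) * e (n + r + 1)) =
      d r * (e (n - r) * e (n + r)) -
        q ^ (2 * r + 1) * d r * ((1 - q ^ (n - r)) * e (n - r) * e (n + r + 1)) := by
    intro r hr
    obtain ⟨A, rfl⟩ := Nat.exists_eq_add_of_le (Nat.lt_succ_iff.1 (mem_range.1 hr))
    rw [he (r + A + r), Nat.add_sub_cancel_left]; ring
  rw [sum_congr rfl h1, sum_sub_distrib, sum_range_succ' (fun r => c r * _),
    sum_range_succ' (fun r => d r * _), sum_range_succ _ n, hc0]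
  simp only [Nat.sub_self, pow_zero, sub_self, zero_mul, mul_zero, add_zero]
  rw [add_sub_right_comm, ← sum_sub_distrib]
  congr 1
  refine sum_congr rfl fun r hr => ?_
  have hr' := mem_range.1 hr
  rw [hc, show n - r = n - (r + 1) + 1 by omega, ← he, add_assoc n r 1]
  ring

end Finite

end RogersRamanujan

namespace RogersRamanujan

open Finset

/-! ### Passage to formal power series and the Rogers–Ramanujan identities -/

section Limits

open PowerSeries Filter Topology

theorem X_pow_dvd_pow {q : ℚ⟦X⟧} (hq : constantCoeff q = 0) (n : ℕ) : (X : ℚ⟦X⟧) ^ n ∣ q ^ n :=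
  pow_dvd_pow_of_dvd (X_dvd_iff.2 hq) n

theorem one_sub_pow_succ_ne_zero {q : ℚ⟦X⟧} (hq : constantCoeff q = 0) (n : ℕ) :
    1 - q ^ (n + 1) ≠ 0 := by
  intro h
  have := congrArg (constantCoeff (R := ℚ)) h
  simp [hq] at this

theorem constantCoeff_qPochhammer {q : ℚ⟦X⟧} (hq : constantCoeff q = 0) (n : ℕ) :
    constantCoeff (qPochhammer q q n) = 1 := by
  simp [qPochhammer, map_prod, hq]

theorem qPochhammer_mul_inv {q : ℚ⟦X⟧} (hq : constantCoeff q = 0) (n : ℕ) :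
    qPochhammer q q n * (qPochhammer q q n)⁻¹ = 1 :=
  PowerSeries.mul_inv_cancel _ (by simp [constantCoeff_qPochhammer hq])

theorem qPochhammer_succ {R : Type*} [CommRing R] (q : R) (n : ℕ) :
    qPochhammer q q (n + 1) = qPochhammer q q n * (1 - q ^ (n + 1)) := by
  rw [qPochhammer, prod_range_succ, ← pow_succ', qPochhammer]

theorem inv_qPochhammer_eq {q : ℚ⟦X⟧} (hq : constantCoeff q = 0) (n : ℕ) :
    (qPochhammer q q n)⁻¹ = (1 - q ^ (n + 1)) * (qPochhammer q q (n + 1))⁻¹ := by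
  have h1 := qPochhammer_mul_inv hq n
  have h2 := qPochhammer_mul_inv hq (n + 1)
  rw [qPochhammer_succ] at h2 ⊢
  linear_combination (1 - q ^ (n + 1)) * (qPochhammer q q n * (1 - q ^ (n + 1)))⁻¹ * h1 -
    (qPochhammer q q n)⁻¹ * h2

theorem inv_qPochhammer_zero (q : ℚ⟦X⟧) : (qPochhammer q q 0)⁻¹ = 1 := by
  simp [qPochhammer]

/-- Since the n-th increment is divisible by X^(n+1), the coefficient of X^d no longer changes from
index d on. -/
theorem exists_tendsto_of_dvd {e : ℕ → ℚ⟦X⟧} (he : ∀ n, X ^ (n + 1) ∣ e (n + 1) - e n) :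
    ∃ L, Tendsto e atTop (𝓝 L) := by
  refine ⟨PowerSeries.mk fun d => coeff d (e d), ?_⟩
  rw [PowerSeries.WithPiTopology.tendsto_iff_coeff_tendsto]
  intro d
  refine tendsto_atTop_of_eventually_const (i₀ := d) fun n hn => ?_
  rw [coeff_mk]
  induction n, hn using Nat.le_induction with
  | base => rfl
  | succ n hn ih =>
    rw [← ih, ← sub_eq_zero, ← map_sub]
    exact X_pow_dvd_iff.1 (he n) d (by omega)

theorem tendsto_inv_qPochhammer {q : ℚ⟦X⟧} (hq : constantCoeff q = 0) :
    ∃ L, Tendsto (fun n => (qPochhammer q q n)⁻¹) atTop (𝓝 L) := by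
  refine exists_tendsto_of_dvd fun n => ?_
  rw [inv_qPochhammer_eq hq n]
  refine (X_pow_dvd_pow hq (n + 1)).trans ⟨(qPochhammer q q (n + 1))⁻¹, by ring⟩

theorem tendsto_qPochhammer {q : ℚ⟦X⟧} (hq : constantCoeff q = 0) :
    ∃ L, Tendsto (fun n => qPochhammer q q n) atTop (𝓝 L) := by
  refine exists_tendsto_of_dvd fun n => ?_
  rw [qPochhammer_succ]
  refine (X_pow_dvd_pow hq (n + 1)).trans ⟨-qPochhammer q q n, by ring⟩

theorem summable_of_X_pow_dvd {t : ℕ → ℚ⟦X⟧} (ht : ∀ r, X ^ r ∣ t r) : Summable t := by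
  rw [PowerSeries.WithPiTopology.summable_iff_summable_coeff]
  intro d
  refine summable_of_ne_finset_zero (s := range (d + 1)) fun r hr => ?_
  exact X_pow_dvd_iff.1 (ht r) d (by simpa using hr)

/-- Termwise passage to the limit in a sum of power series. -/
theorem tendsto_sum_of_X_pow_dvd {t : ℕ → ℕ → ℚ⟦X⟧} {u : ℕ → ℚ⟦X⟧}
    (ht : ∀ n r, r ≤ n → X ^ r ∣ t n r) (htu : ∀ r, Tendsto (fun n => t n r) atTop (𝓝 (u r)))
    (hu : ∀ r, X ^ r ∣ u r) :
    Tendsto (fun n => ∑ r ∈ range (n + 1), t n r) atTop (𝓝 (∑' r, u r)) := by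
  have hs := (PowerSeries.WithPiTopology.hasSum_iff_hasSum_coeff ℚ).1
    (summable_of_X_pow_dvd hu).hasSum
  rw [PowerSeries.WithPiTopology.tendsto_iff_coeff_tendsto]
  intro d
  have h1 : coeff d (∑' r, u r) = ∑ r ∈ range (d + 1), coeff d (u r) :=
    (hs d).unique (hasSum_sum_of_ne_finset_zero fun r hr =>
      X_pow_dvd_iff.1 (hu r) d (by simpa using hr))
  rw [h1]
  have h2 : Tendsto (fun n => ∑ r ∈ range (d + 1), coeff d (t n r)) atTop
      (𝓝 (∑ r ∈ range (d + 1), coeff d (u r))) :=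
    tendsto_finsetSum _ fun r _ =>
      (PowerSeries.WithPiTopology.tendsto_iff_coeff_tendsto _ _ _ _).1 (htu r) d
  refine h2.congr' ?_
  filter_upwards [eventually_ge_atTop d] with n hn
  rw [map_sum]
  refine sum_subset (range_subset_range.2 (by omega)) fun r hr hr' => ?_
  exact X_pow_dvd_iff.1 (ht n r (by simpa [Nat.lt_succ_iff] using hr)) d (by simpa using hr')

theorem tendsto_sub_nat (r : ℕ) : Tendsto (fun n : ℕ => n - r) atTop atTop :=
  tendsto_sub_atTop_nat r

theorem tendsto_add_nat (r a : ℕ) : Tendsto (fun n : ℕ => n + r + a) atTop atTop :=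
  (tendsto_add_atTop_nat (r + a)).congr fun n => (add_assoc n r a).symm

/-- The limiting form of the Jacobi triple product identity. -/
theorem tendsto_triple_product {x y q P : ℚ⟦X⟧} (hxy : x * y = q) (hx : constantCoeff x = 0)
    (hy : constantCoeff y = 0) (hP : Tendsto (fun n => qPochhammer q q n) atTop (𝓝 P)) :
    (∀ r, X ^ r ∣ thetaCoeff x y r) ∧
    ∃ T, Tendsto (fun n => ∏ i ∈ range n, ((1 - x * q ^ i) * (1 - y * q ^ i))) atTop (𝓝 T) ∧
      P * T = ∑' r, thetaCoeff x y r := by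
  have hq : constantCoeff q = 0 := by rw [← hxy]; simp [hx]
  obtain ⟨L, hL⟩ := tendsto_inv_qPochhammer hq
  have hPL : P * L = 1 := tendsto_nhds_unique (hP.mul hL)
    (by simp only [qPochhammer_mul_inv hq]; exact tendsto_const_nhds)
  have hdvd : ∀ r, X ^ r ∣ thetaCoeff x y r := by
    intro r
    rcases r with _ | r
    · simp
    · rw [thetaCoeff_succ]
      exact Dvd.dvd.mul_left (dvd_add (X_pow_dvd_pow hx _) (X_pow_dvd_pow hy _)) _
  have hlim : Tendsto (fun n => ∑ r ∈ range (n + 1), thetaCoeff x y r *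
      ((qPochhammer q q (n - r))⁻¹ * (qPochhammer q q (n + r))⁻¹)) atTop
      (𝓝 (∑' r, thetaCoeff x y r * (L * L))) := by
    refine tendsto_sum_of_X_pow_dvd (fun n r _ => (hdvd r).mul_right _) (fun r => ?_)
      (fun r => (hdvd r).mul_right _)
    exact tendsto_const_nhds.mul ((hL.comp (tendsto_sub_nat r)).mul
      (hL.comp (tendsto_add_atTop_nat r)))
  have hsum := summable_of_X_pow_dvd hdvd
  rw [hsum.tsum_mul_right] at hlim
  refine ⟨hdvd, P * ((∑' r, thetaCoeff x y r) * (L * L)), ?_, ?_⟩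
  · have h2 : Tendsto (fun n : ℕ => 2 * n) atTop atTop :=
      tendsto_atTop_mono (fun n => by simp only [id]; omega) tendsto_id
    -- Multiplying the finite identity by (q; q)_(2n) cancels the factor e(2n) and isolates the
    -- product.
    refine ((hP.comp h2).mul hlim).congr fun n => ?_
    simp only [Function.comp]
    rw [finite_triple_product (e := fun n => (qPochhammer q q n)⁻¹) hxy
      (one_sub_pow_succ_ne_zero hq) (inv_qPochhammer_zero q) (inv_qPochhammer_eq hq),
      ← mul_assoc, qPochhammer_mul_inv hq, one_mul]
  · linear_combination (P * L + 1) * (∑' r, thetaCoeff x y r) * hPL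

/-- The limiting form of two steps along a Bailey chain. -/
theorem tsum_bailey {α : ℕ → ℚ⟦X⟧} (a : ℕ) {P : ℚ⟦X⟧}
    (hP : Tendsto (fun n => qPochhammer (X : ℚ⟦X⟧) X n) atTop (𝓝 P))
    (h : ∀ n, (if n = 0 then 1 else 0) = ∑ r ∈ range (n + 1), α r *
      ((qPochhammer (X : ℚ⟦X⟧) X (n - r))⁻¹ * (qPochhammer (X : ℚ⟦X⟧) X (n + r + a))⁻¹)) :
    P * ∑' s : ℕ, (X : ℚ⟦X⟧) ^ (s ^ 2 + a * s) * (qPochhammer (X : ℚ⟦X⟧) X s)⁻¹ =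
      ∑' r : ℕ, (X : ℚ⟦X⟧) ^ (2 * (r ^ 2 + a * r)) * α r := by
  have hX : constantCoeff (X : ℚ⟦X⟧) = 0 := by simp
  set e : ℕ → ℚ⟦X⟧ := fun n => (qPochhammer (X : ℚ⟦X⟧) X n)⁻¹ with he
  have hq := one_sub_pow_succ_ne_zero hX
  have h0 : e 0 = 1 := inv_qPochhammer_zero X
  have hs : ∀ n, e n = (1 - X ^ (n + 1)) * e (n + 1) := inv_qPochhammer_eq hX
  obtain ⟨L, hL⟩ := tendsto_inv_qPochhammer hX
  have hPL : P * L = 1 := tendsto_nhds_unique (hP.mul hL)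
    (by simp only [qPochhammer_mul_inv hX]; exact tendsto_const_nhds)
  -- For the unit pair only s = 0 survives on the left of `bailey_step`, leaving e(n). Hence e
  -- itself is the β-sequence of the next Bailey pair.
  have step1 : ∀ n, e n =
      ∑ r ∈ range (n + 1), X ^ (r ^ 2 + a * r) * α r * (e (n - r) * e (n + r + a)) := by
    intro n
    rw [← bailey_step hq h0 hs a h n, sum_range_succ']
    simp
  have step2 := bailey_step hq h0 hs a step1
  have hdvd : ∀ (s : ℕ) (f : ℚ⟦X⟧), X ^ s ∣ X ^ (s ^ 2 + a * s) * f := fun s f =>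
    (pow_dvd_pow X (by nlinarith)).mul_right f
  have hdvd2 : ∀ (s : ℕ) (f : ℚ⟦X⟧), X ^ s ∣ X ^ (2 * (s ^ 2 + a * s)) * f := fun s f =>
    (pow_dvd_pow X (by nlinarith)).mul_right f
  have lim1 : Tendsto (fun n => ∑ s ∈ range (n + 1), X ^ (s ^ 2 + a * s) * e s * e (n - s)) atTop
      (𝓝 (∑' s : ℕ, X ^ (s ^ 2 + a * s) * e s * L)) := by
    refine tendsto_sum_of_X_pow_dvd (fun n r _ => (hdvd r _).mul_right _) (fun r => ?_)
      (fun r => (hdvd r _).mul_right _)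
    exact tendsto_const_nhds.mul (hL.comp (tendsto_sub_nat r))
  have lim2 : Tendsto (fun n => ∑ r ∈ range (n + 1), X ^ (2 * (r ^ 2 + a * r)) * α r *
      (e (n - r) * e (n + r + a))) atTop
      (𝓝 (∑' r : ℕ, X ^ (2 * (r ^ 2 + a * r)) * α r * (L * L))) := by
    refine tendsto_sum_of_X_pow_dvd (fun n r _ => (hdvd2 r _).mul_right _) (fun r => ?_)
      (fun r => (hdvd2 r _).mul_right _)
    exact tendsto_const_nhds.mul ((hL.comp (tendsto_sub_nat r)).mul (hL.comp (tendsto_add_nat r a)))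
  rw [(summable_of_X_pow_dvd fun s => hdvd s (e s)).tsum_mul_right] at lim1
  rw [(summable_of_X_pow_dvd fun s => hdvd2 s (α s)).tsum_mul_right] at lim2
  have heq := tendsto_nhds_unique lim1 (lim2.congr fun n => by
    rw [step2 n]
    refine sum_congr rfl fun r _ => ?_
    rw [two_mul, pow_add]; ring)
  linear_combination (P ^ 2) * heq - (P * ∑' s : ℕ, X ^ (s ^ 2 + a * s) * e s) * hPL +
    (∑' r : ℕ, X ^ (2 * (r ^ 2 + a * r)) * α r) * (P * L + 1) * hPL

/-! ### Product side and comparison of the two sides -/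

/-- The product formula for the generating function of restricted partitions modulo `δ`. -/
theorem hasProd_partitionCount (δ g : ℕ) [NeZero δ] :
    HasProd (fun n : ℕ => ∏ i : Fin δ, if (((i : ℕ) + 1 : ℕ) : ℤ) ≡ g [ZMOD δ] ∨
      (((i : ℕ) + 1 : ℕ) : ℤ) ≡ -g [ZMOD δ] then (1 - (X : ℚ⟦X⟧) ^ (δ * n + i + 1))⁻¹ else 1)
      (PowerSeries.mk fun n => (partitionCount g δ n : ℚ)) := by
  have h := Nat.Partition.hasProd_powerSeriesMk_card_restricted ℚ
    (fun i => (i : ℤ) ≡ (g : ℤ) [ZMOD (δ : ℤ)] ∨ (i : ℤ) ≡ -(g : ℤ) [ZMOD (δ : ℤ)])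
  have hinv : ∀ i : ℕ, ∑' j : ℕ, (X : ℚ⟦X⟧) ^ ((i + 1) * j) = (1 - (X : ℚ⟦X⟧) ^ (i + 1))⁻¹ := by
    intro i
    have h1 := PowerSeries.WithPiTopology.tsum_pow_mul_one_sub_of_constantCoeff_eq_zero
      (f := (X : ℚ⟦X⟧) ^ (i + 1)) (by simp)
    simp_rw [pow_mul]
    rw [PowerSeries.eq_inv_iff_mul_eq_one (by simp)]
    exact h1
  simp_rw [hinv] at h
  -- Parts are grouped into blocks δn + 1, ..., δn + δ; the congruence condition depends only on the
  -- position in the block.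
  have h2 := (Nat.divModEquiv δ).symm.hasProd_iff.2 h
  have h3 := h2.prod_fiberwise (fun n => hasProd_fintype _)
  refine h3.congr_fun fun n => Finset.prod_congr rfl fun i _ => ?_
  simp only [Function.comp, Nat.divModEquiv_symm_apply]
  have hmod : (((n * δ + i : ℕ) + 1 : ℕ) : ℤ) ≡ (((i : ℕ) + 1 : ℕ) : ℤ) [ZMOD δ] := by
    refine Int.modEq_iff_dvd.2 ⟨-n, ?_⟩
    push_cast; ring
  have hiff : ∀ z : ℤ, ((((n * δ + i : ℕ) + 1 : ℕ) : ℤ) ≡ z [ZMOD δ] ↔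
      (((i : ℕ) + 1 : ℕ) : ℤ) ≡ z [ZMOD δ]) := fun z => ⟨hmod.symm.trans, hmod.trans⟩
  simp only [hiff]
  rw [mul_comm δ n]

/-- The factors are sorted by residue modulo 5: 0, then ±1, then ±2. The last two groups are the
finite triple products with q replaced by q^5. -/
theorem qPochhammer_five_mul (n : ℕ) : qPochhammer (X : ℚ⟦X⟧) X (5 * n) =
    qPochhammer ((X : ℚ⟦X⟧) ^ 5) (X ^ 5) n *
      (∏ i ∈ range n, ((1 - X ^ 4 * (X ^ 5) ^ i) * (1 - X * (X ^ 5) ^ i))) *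
      ∏ i ∈ range n, ((1 - X ^ 2 * (X ^ 5) ^ i) * (1 - X ^ 3 * (X ^ 5) ^ i)) := by
  induction n with
  | zero => simp [qPochhammer]
  | succ n ih =>
    rw [show 5 * (n + 1) = 5 * n + 1 + 1 + 1 + 1 + 1 by ring]
    simp only [qPochhammer_succ, prod_range_succ]
    rw [ih]
    ring

/-- The theta series for a = 0 is put in triple product form, by 2r² + C(r,2) = 5 C(r,2) + 2r. -/
theorem X_pow_mul_thetaCoeff (r : ℕ) : (X : ℚ⟦X⟧) ^ (2 * (r ^ 2 + 0 * r)) * thetaCoeff 1 X r =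
    thetaCoeff (X ^ 2) (X ^ 3) r := by
  rcases r with _ | r
  · simp [thetaCoeff]
  · have h : 2 * (r + 1).choose 2 = (r + 1) * r := by
      rw [Nat.choose_two_right, Nat.add_sub_cancel,
        Nat.mul_div_cancel' (by rw [mul_comm]; exact (Nat.even_mul_succ_self r).two_dvd)]
    have h5 : ((X : ℚ⟦X⟧) ^ 2 * X ^ 3) ^ ((r + 1).choose 2) =
        X ^ ((r + 1).choose 2) * X ^ (2 * ((r + 1) * r)) := by
      rw [← h, ← pow_add, ← pow_add, ← pow_mul]; congr 1; ring
    rw [thetaCoeff_succ, thetaCoeff_succ, h5, one_mul, one_pow]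
    ring

/-- The analogue for a = 1. Here the summands differ and only the totals agree: each summand on the
left is D(r) - q^(2r+1) D(r), and the theta terms pair D(r+1) with q^(2r+1) D(r). -/
theorem tsum_X_pow_mul_eq_tsum_thetaCoeff :
    ∑' r : ℕ, (X : ℚ⟦X⟧) ^ (2 * (r ^ 2 + 1 * r)) *
      ((-1) ^ r * X ^ (r.choose 2) * (1 - X ^ (2 * r + 1))) =
    ∑' r, thetaCoeff ((X : ℚ⟦X⟧) ^ 4) X r := by
  set D : ℕ → ℚ⟦X⟧ := fun r => X ^ (2 * (r ^ 2 + r)) * ((-1) ^ r * X ^ (r.choose 2)) with hD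
  have hdvd : ∀ r, X ^ r ∣ D r := fun r => (pow_dvd_pow X (by nlinarith)).mul_right _
  have hs := summable_of_X_pow_dvd hdvd
  have hs2 : Summable fun r => X ^ (2 * r + 1) * D r :=
    summable_of_X_pow_dvd fun r => (hdvd r).mul_left _
  have hs1 : Summable fun r => D (r + 1) :=
    summable_of_X_pow_dvd fun r => (pow_dvd_pow X (Nat.le_succ r)).trans (hdvd _)
  have hθ : Summable (thetaCoeff ((X : ℚ⟦X⟧) ^ 4) X) := by
    refine summable_of_X_pow_dvd fun r => ?_
    rcases r with _ | r
    · simp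
    · rw [thetaCoeff_succ]
      exact Dvd.dvd.mul_left (dvd_add (X_pow_dvd_pow (by simp) _) (dvd_refl _)) _
  have h1 : ∀ r, thetaCoeff ((X : ℚ⟦X⟧) ^ 4) X (r + 1) = D (r + 1) - X ^ (2 * r + 1) * D r := by
    intro r
    have h : 2 * (r + 1).choose 2 = (r + 1) * r := by
      rw [Nat.choose_two_right, Nat.add_sub_cancel,
        Nat.mul_div_cancel' (by rw [mul_comm]; exact (Nat.even_mul_succ_self r).two_dvd)]
    have h5 : ((X : ℚ⟦X⟧) ^ 4 * X) ^ ((r + 1).choose 2) =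
        X ^ ((r + 1).choose 2) * X ^ (2 * ((r + 1) * r)) := by
      rw [← h, ← pow_succ, ← pow_add, ← pow_mul]; congr 1; ring
    have hc : (r + 1).choose 2 = r + r.choose 2 := by
      rw [Nat.choose_succ_succ' r 1, Nat.choose_one_right]
    rw [thetaCoeff_succ, h5, hc]
    simp only [hD, hc]
    ring
  rw [hθ.tsum_eq_zero_add]
  simp_rw [h1]
  rw [hs1.tsum_sub hs2, show thetaCoeff ((X : ℚ⟦X⟧) ^ 4) X 0 = D 0 by simp [thetaCoeff, hD],
    ← add_sub_assoc, ← hs.tsum_eq_zero_add, ← hs.tsum_sub hs2]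
  refine tsum_congr fun r => ?_
  simp only [hD, one_mul]
  ring

/-- The unit Bailey pair relative to q, deduced from the one relative to 1 by `sum_shift`. -/
theorem unit_pair_one (n : ℕ) : (if n = 0 then 1 else 0) =
    ∑ r ∈ range (n + 1), ((-1) ^ r * X ^ (r.choose 2) * (1 - X ^ (2 * r + 1))) *
      ((qPochhammer (X : ℚ⟦X⟧) X (n - r))⁻¹ * (qPochhammer (X : ℚ⟦X⟧) X (n + r + 1))⁻¹) := by
  have hX : constantCoeff (X : ℚ⟦X⟧) = 0 := by simp
  rw [unit_pair_zero (one_sub_pow_succ_ne_zero hX) (inv_qPochhammer_zero X) (inv_qPochhammer_eq hX),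
    sum_shift (inv_qPochhammer_eq hX) (d := fun r => (-1) ^ r * X ^ (r.choose 2))]
  · simp [thetaCoeff]
  · intro r
    have hc : (r + 1).choose 2 = r + r.choose 2 := by
      rw [Nat.choose_succ_succ' r 1, Nat.choose_one_right]
    rw [thetaCoeff_succ, hc]
    ring

theorem hasProd_partitionCount_five {a : ℕ} (ha : a = 0 ∨ a = 1) :
    HasProd (fun n : ℕ => ((1 - (X : ℚ⟦X⟧) ^ (5 * n + a + 1)) *
          (1 - (X : ℚ⟦X⟧) ^ (5 * n + 4 - a)))⁻¹)
        (PowerSeries.mk fun n => (partitionCount (a + 1) 5 n : ℚ)) := by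
  refine (hasProd_partitionCount 5 (a + 1)).congr_fun fun n => ?_
  rw [Fin.prod_univ_five, PowerSeries.mul_inv_rev]
  rcases ha with rfl | rfl
  · simp [Int.ModEq, mul_comm]
  · simp [Int.ModEq, mul_comm, add_assoc]

theorem eq_of_tendsto_prod {f : ℕ → ℚ⟦X⟧} {A T : ℚ⟦X⟧} (hf : ∀ n, constantCoeff (f n) = 1)
    (hA : HasProd (fun n => (f n)⁻¹) A)
    (hT : Tendsto (fun n => ∏ i ∈ range n, f i) atTop (𝓝 T)) : A * T = 1 := by
  refine tendsto_nhds_unique (hA.tendsto_prod_nat.mul hT) ?_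
  simp_rw [← prod_mul_distrib]
  simp [PowerSeries.inv_mul_cancel _ (show constantCoeff (f _) ≠ 0 by simp [hf])]

/-- The Rogers–Ramanujan identities. -/
theorem hasSum_rogersRamanujan {a : ℕ} (ha : a = 0 ∨ a = 1) :
    HasSum (fun n : ℕ => (X : ℚ⟦X⟧) ^ (n ^ 2 + a * n) * (qPochhammer (X : ℚ⟦X⟧) X n)⁻¹)
      (PowerSeries.mk fun n => (partitionCount (a + 1) 5 n : ℚ)) := by
  have hX : constantCoeff (X : ℚ⟦X⟧) = 0 := by simp
  have hX5 : constantCoeff ((X : ℚ⟦X⟧) ^ 5) = 0 := by simp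
  obtain ⟨P, hP⟩ := tendsto_qPochhammer hX
  obtain ⟨P₅, hP₅⟩ := tendsto_qPochhammer hX5
  obtain ⟨L, hL⟩ := tendsto_inv_qPochhammer hX
  have hPL : P * L = 1 := tendsto_nhds_unique (hP.mul hL)
    (by simp only [qPochhammer_mul_inv hX]; exact tendsto_const_nhds)
  have hP0 : P ≠ 0 := left_ne_zero_of_mul_eq_one hPL
  obtain ⟨-, T₁, hT₁, hθ₁⟩ := tendsto_triple_product (x := X ^ 4) (y := X) (q := X ^ 5)
    (by ring) (by simp) (by simp) hP₅
  obtain ⟨-, T₂, hT₂, hθ₂⟩ := tendsto_triple_product (x := X ^ 2) (y := X ^ 3) (q := X ^ 5)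
    (by ring) (by simp) (by simp) hP₅
  have h5 : Tendsto (fun n : ℕ => 5 * n) atTop atTop :=
    tendsto_atTop_mono (fun n => by simp only [id]; omega) tendsto_id
  -- Limits along 5n of the residue splitting. The chain gives P times the sum as P₅T₂ (a = 0) or
  -- P₅T₁ (a = 1), so the sum is 1/T₁ or 1/T₂.
  have hfac : P = P₅ * T₁ * T₂ := tendsto_nhds_unique (hP.comp h5)
    (((hP₅.mul hT₁).mul hT₂).congr fun n => (qPochhammer_five_mul n).symm)
  have hsum : Summable fun n : ℕ =>
      (X : ℚ⟦X⟧) ^ (n ^ 2 + a * n) * (qPochhammer (X : ℚ⟦X⟧) X n)⁻¹ :=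
    summable_of_X_pow_dvd fun s => (pow_dvd_pow X (by nlinarith)).mul_right _
  rw [hsum.hasSum_iff]
  have hA := hasProd_partitionCount_five ha
  rcases ha with rfl | rfl
  · have hAT : (PowerSeries.mk fun n => (partitionCount (0 + 1) 5 n : ℚ)) * T₁ = 1 := by
      refine eq_of_tendsto_prod (fun n => ?_) hA (hT₁.congr fun n => prod_congr rfl fun i _ => ?_)
      · simp
      · rw [Nat.sub_zero]; ring
    have hb := tsum_bailey 0 hP (fun n => unit_pair_zero (one_sub_pow_succ_ne_zero hX)
      (inv_qPochhammer_zero X) (inv_qPochhammer_eq hX) n)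
    simp_rw [X_pow_mul_thetaCoeff] at hb
    rw [← hθ₂] at hb
    apply mul_left_cancel₀ hP0
    rw [hb]
    linear_combination (-(P₅ * T₂)) * hAT -
      (PowerSeries.mk fun n => (partitionCount (0 + 1) 5 n : ℚ)) * hfac
  · have hAT : (PowerSeries.mk fun n => (partitionCount (1 + 1) 5 n : ℚ)) * T₂ = 1 := by
      refine eq_of_tendsto_prod (fun n => ?_) hA (hT₂.congr fun n => prod_congr rfl fun i _ => ?_)
      · simp [show 5 * n + 4 - 1 = 5 * n + 3 by omega]
      · rw [show 5 * i + 4 - 1 = 5 * i + 3 by omega]; ring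
    have hb := tsum_bailey 1 hP unit_pair_one
    rw [tsum_X_pow_mul_eq_tsum_thetaCoeff, ← hθ₁] at hb
    apply mul_left_cancel₀ hP0
    rw [hb]
    linear_combination (-(P₅ * T₁)) * hAT -
      (PowerSeries.mk fun n => (partitionCount (1 + 1) 5 n : ℚ)) * hfac

end Limits

end RogersRamanujan

/-! ### Equidistribution of locally affine sequences modulo a period -/

namespace Benford

open Filter Topology Finset

/-- A real sequence that is, around every large `n`, uniformly close to an affine function of small
positive slope `α` on a window of radius `K / α`, where `1 / α = o(n)`. -/
def LocallyAffine (f : ℕ → ℝ) : Prop :=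
  ∀ K ε : ℝ, 0 < K → 0 < ε → ∀ᶠ n : ℕ in atTop, ∃ α : ℝ, 0 < α ∧ α ≤ ε ∧ 1 / α ≤ ε * n ∧
    ∀ m : ℕ, |(m : ℝ) - n| ≤ K / α → |f m - f n - α * (m - n)| ≤ ε

/-- The union of the translates of `[u, v)` by integer multiples of `T`. -/
def periodicInterval (T u v : ℝ) : Set ℝ := {y | ∃ j : ℤ, u + j * T ≤ y ∧ y < v + j * T}

theorem card_le_of_mem_interval {s : Finset ℕ} {x y : ℝ} (hxy : x ≤ y)
    (hs : ∀ m ∈ s, x ≤ (m : ℝ) ∧ (m : ℝ) ≤ y) : (s.card : ℝ) ≤ y - x + 1 := by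
  rcases s.eq_empty_or_nonempty with rfl | hne
  · simp; linarith
  · have h1 : s ⊆ Icc (s.min' hne) (s.max' hne) := fun m hm =>
      mem_Icc.2 ⟨s.min'_le m hm, s.le_max' m hm⟩
    have h2 := card_le_card h1
    rw [Nat.card_Icc] at h2
    have h3 := hs _ (s.min'_mem hne)
    have h4 := hs _ (s.max'_mem hne)
    have h5 : s.min' hne ≤ s.max' hne := s.min'_le _ (s.max'_mem hne)
    have h6 : (s.card : ℝ) ≤ (s.max' hne : ℝ) + 1 - s.min' hne := by
      rw [← Nat.cast_add_one, ← Nat.cast_sub (by omega)]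
      exact_mod_cast h2
    linarith

theorem card_int_Icc_le {x y : ℝ} (hxy : x ≤ y) :
    ((Finset.Icc ⌊x⌋ ⌊y⌋).card : ℝ) ≤ y - x + 2 := by
  rw [Int.card_Icc]
  have h1 : ⌊x⌋ ≤ ⌊y⌋ := Int.floor_mono hxy
  have h2 : (((⌊y⌋ + 1 - ⌊x⌋).toNat : ℤ) : ℝ) = (⌊y⌋ : ℝ) + 1 - ⌊x⌋ := by
    rw [Int.toNat_of_nonneg (by omega)]; push_cast; ring
  have h3 : (((⌊y⌋ + 1 - ⌊x⌋).toNat : ℕ) : ℝ) = (⌊y⌋ : ℝ) + 1 - ⌊x⌋ := by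
    rw [← h2]; norm_cast
  rw [h3]
  linarith [Int.floor_le y, Int.lt_floor_add_one x]

-- On a window of L = ⌊K/α⌋ indices f rises by about K, so it meets about K/T translates of [u, v).
-- It stays in each for about (v - u)/α indices, which makes about (v - u)L/T in total.
open Classical in
theorem block_count {f : ℕ → ℝ} (hf : LocallyAffine f) {T u v η : ℝ} (hT : 0 < T) (huv : u ≤ v)
    (hη : 0 < η) : ∀ᶠ n : ℕ in atTop, ∃ L : ℕ, 1 ≤ L ∧ (L : ℝ) ≤ η * n ∧
      (((Ico n (n + L)).filter fun m => f m ∈ periodicInterval T u v).card : ℝ) ≤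
        ((v - u) / T + η) * L := by
  -- K is taken so large that all boundary effects, relatively of order 1/K, fit into η. The left
  -- side is the bound met below for the count times α/K, and the right side allows for L α ≥ K -
  -- 1/K.
  obtain ⟨K, hK2, hK⟩ : ∃ K : ℝ, 2 ≤ K ∧ ((1 + 2 / K * (1 / K) + (v - u) / K) / T + 2 / K) *
      (v - u + 3 / K) <
      ((v - u) / T + η) * (1 - 1 / K * (1 / K)) := by
    have h1 : ∀ c : ℝ, Tendsto (fun K : ℝ => c / K) atTop (𝓝 0) := fun c =>
      tendsto_const_nhds.div_atTop tendsto_id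
    have hl : Tendsto (fun K : ℝ => ((1 + 2 / K * (1 / K) + (v - u) / K) / T + 2 / K) *
        (v - u + 3 / K)) atTop (𝓝 (((1 + 0 * 0 + 0) / T + 0) * (v - u + 0))) :=
      ((((tendsto_const_nhds.add ((h1 2).mul (h1 1))).add (h1 _)).div_const T).add (h1 2)).mul
        (tendsto_const_nhds.add (h1 3))
    have hr : Tendsto (fun K : ℝ => ((v - u) / T + η) * (1 - 1 / K * (1 / K))) atTop
        (𝓝 (((v - u) / T + η) * (1 - 0 * 0))) :=
      tendsto_const_nhds.mul (tendsto_const_nhds.sub ((h1 1).mul (h1 1)))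
    have hlt : ((1 + 0 * 0 + 0) / T + 0) * (v - u + 0) < ((v - u) / T + η) * (1 - 0 * 0) := by
      have : ((1 + 0 * 0 + 0) / T + 0) * (v - u + 0) = (v - u) / T := by ring
      rw [this]; linarith
    obtain ⟨K, h2, h3⟩ := ((eventually_ge_atTop 2).and (hl.eventually_lt hr hlt)).exists
    exact ⟨K, h2, h3⟩
  have hK0 : 0 < K := by linarith
  have hε0 : 0 < min (1 / K) (η / K) := lt_min (by positivity) (by positivity)
  filter_upwards [hf K (min (1 / K) (η / K)) hK0 hε0] with n hn
  obtain ⟨α, hα, hαε, hαn, hwin⟩ := hn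
  set ε := min (1 / K) (η / K) with hε
  have hεK : ε ≤ 1 / K := min_le_left _ _
  have hεη : ε ≤ η / K := min_le_right _ _
  have hα1 : α ≤ 1 / K := hαε.trans hεK
  have hKα : K ≤ 1 / α := by
    rw [le_div_iff₀ hα, mul_comm]; rwa [le_div_iff₀ hK0] at hα1
  set L := ⌊K / α⌋₊ with hL
  have hL1 : (L : ℝ) ≤ K / α := Nat.floor_le (by positivity)
  have hL2 : K / α < L + 1 := Nat.lt_floor_add_one _
  have hLα1 : L * α ≤ K := by rwa [le_div_iff₀ hα] at hL1
  have hLα2 : K - α < L * α := by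
    rw [div_lt_iff₀ hα] at hL2; linarith
  refine ⟨L, ?_, ?_, ?_⟩
  · refine Nat.le_floor ?_
    rw [Nat.cast_one, div_eq_mul_one_div]
    nlinarith
  · calc (L : ℝ) ≤ K * (1 / α) := by rw [mul_one_div]; exact hL1
      _ ≤ K * (ε * n) := by gcongr
      _ ≤ K * (η / K * n) := by gcongr
      _ = η * n := by field_simp
  · have hw0 : 0 ≤ v - u := by linarith
    have hdev : ∀ m ∈ Ico n (n + L), |f m - f n - α * (m - n)| ≤ ε ∧ 0 ≤ (m : ℝ) - n ∧
        α * ((m : ℝ) - n) ≤ K := by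
      intro m hm
      rw [mem_Ico] at hm
      have h1 : (n : ℝ) ≤ m := by exact_mod_cast hm.1
      have h2 : (m : ℝ) < n + L := by exact_mod_cast hm.2
      refine ⟨hwin m ?_, by linarith, ?_⟩
      · rw [abs_of_nonneg (by linarith)]; linarith
      · nlinarith
    set s := (Ico n (n + L)).filter fun m => f m ∈ periodicInterval T u v with hs
    have hch : ∀ m ∈ s, ∃ j : ℤ, u + j * T ≤ f m ∧ f m < v + j * T := fun m hm => (mem_filter.1 hm).2
    -- `j m` picks a translate containing f(m). Indices sharing a translate lie in a real interval
    -- of length (v - u + 2ε)/α, and few values of j occur.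
    set j : ℕ → ℤ := fun m => if h : m ∈ s then (hch m h).choose else 0 with hj
    have hjs : ∀ m ∈ s, u + j m * T ≤ f m ∧ f m < v + j m * T := by
      intro m hm
      simp only [hj, hm, dif_pos]
      exact (hch m hm).choose_spec
    have hcard := card_le_mul_card_image (f := j) s ⌊(v - u + 2 * ε) / α + 1⌋₊ (by
      intro i hi
      refine Nat.le_floor ?_
      have hlen : (v - u + 2 * ε) / α =
          (n + (v + i * T - f n + ε) / α) - (n + (u + i * T - f n - ε) / α) := by
        field_simp; ring
      rw [hlen]
      refine card_le_of_mem_interval ?_ ?_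
      · have : (u + i * T - f n - ε) / α ≤ (v + i * T - f n + ε) / α := by
          gcongr
          linarith
        linarith
      · intro m hm
        rw [mem_filter] at hm
        obtain ⟨hm1, rfl⟩ := hm
        have h1 := (hdev m (mem_filter.1 hm1).1).1
        rw [abs_le] at h1
        have h2 := hjs m hm1
        constructor
        · rw [← le_sub_iff_add_le', div_le_iff₀ hα]; linarith
        · rw [← sub_le_iff_le_add', le_div_iff₀ hα]; linarith)
    have himg : s.image j ⊆ Finset.Icc ⌊(f n - ε - v) / T⌋ ⌊(f n + K + ε - u) / T⌋ := by
      intro i hi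
      obtain ⟨m, hm, rfl⟩ := mem_image.1 hi
      have h1 := hdev m (mem_filter.1 hm).1
      have h2 := hjs m hm
      have h3 := abs_le.1 h1.1
      rw [mem_Icc]
      constructor
      · have : (f n - ε - v) / T < j m := by
          rw [div_lt_iff₀ hT]
          nlinarith [mul_nonneg hα.le h1.2.1]
        exact_mod_cast (Int.floor_le _).trans this.le
      · rw [Int.le_floor, le_div_iff₀ hT]; linarith
    have himg2 : ((s.image j).card : ℝ) ≤
        K * ((1 + 2 / K * (1 / K) + (v - u) / K) / T + 2 / K) := by
      have h1 : (f n - ε - v) / T ≤ (f n + K + ε - u) / T := by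
        gcongr ?_ / T
        linarith
      calc ((s.image j).card : ℝ) ≤
          ((Finset.Icc ⌊(f n - ε - v) / T⌋ ⌊(f n + K + ε - u) / T⌋).card : ℝ) := by
            exact_mod_cast card_le_card himg
        _ ≤ (f n + K + ε - u) / T - (f n - ε - v) / T + 2 := card_int_Icc_le h1
        _ = (K + 2 * ε + (v - u)) / T + 2 := by ring
        _ ≤ (K + 2 * (1 / K) + (v - u)) / T + 2 := by gcongr
        _ = K * ((1 + 2 / K * (1 / K) + (v - u) / K) / T + 2 / K) := by field_simp
    have hc1 : (s.card : ℝ) ≤ ((v - u + 2 * ε) / α + 1) *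
        (K * ((1 + 2 / K * (1 / K) + (v - u) / K) / T + 2 / K)) := by
      calc (s.card : ℝ) ≤ (⌊(v - u + 2 * ε) / α + 1⌋₊ : ℝ) * ((s.image j).card : ℝ) := by
            exact_mod_cast hcard
        _ ≤ _ := by
            gcongr
            exact Nat.floor_le (by positivity)
    have hM : 0 ≤ (1 + 2 / K * (1 / K) + (v - u) / K) / T + 2 / K := by positivity
    set M := (1 + 2 / K * (1 / K) + (v - u) / K) / T + 2 / K with hMdef
    have hwT : 0 ≤ (v - u) / T := by positivity
    refine le_of_mul_le_mul_right ?_ hα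
    calc (s.card : ℝ) * α ≤ ((v - u + 2 * ε) / α + 1) * (K * M) * α := by gcongr
      _ = K * (M * (v - u + 2 * ε + α)) := by field_simp
      _ ≤ K * (M * (v - u + 3 / K)) := by
          have : 2 * ε + α ≤ 3 / K := by
            have : 3 / K = 3 * (1 / K) := by ring
            linarith
          exact mul_le_mul_of_nonneg_left (mul_le_mul_of_nonneg_left (by linarith) hM) hK0.le
      _ ≤ K * (((v - u) / T + η) * (1 - 1 / K * (1 / K))) := by gcongr
      _ = ((v - u) / T + η) * (K - 1 / K) := by field_simp
      _ ≤ ((v - u) / T + η) * (L * α) := by gcongr; linarith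
      _ = ((v - u) / T + η) * L * α := by ring

-- Blocks are laid end to end from n. Only the last one can overshoot x, and its length is at most η
-- x.
open Classical in
theorem greedy_count {S : ℕ → Prop} {ρ η : ℝ} (hρ : 0 ≤ ρ) {n₀ : ℕ}
    (h : ∀ n, n₀ ≤ n → ∃ L : ℕ, 1 ≤ L ∧ (L : ℝ) ≤ η * n ∧
      (((Ico n (n + L)).filter S).card : ℝ) ≤ ρ * L) (hη : 0 ≤ η) {n x : ℕ} (hn : n₀ ≤ n)
    (hnx : n ≤ x) : (((Ico n x).filter S).card : ℝ) ≤ ρ * (x - n) + η * x := by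
  induction hd : x - n using Nat.strong_induction_on generalizing n with
  | _ d ih =>
    obtain ⟨L, hL1, hL2, hL3⟩ := h n hn
    by_cases hx : n + L ≤ x
    · have h1 := ih (x - (n + L)) (by omega) (n := n + L) (by omega) hx rfl
      have h2 : (Ico n x).filter S = (Ico n (n + L)).filter S ∪ (Ico (n + L) x).filter S := by
        rw [← filter_union, Ico_union_Ico_eq_Ico (by omega) hx]
      have h3 : (((Ico n x).filter S).card : ℝ) ≤
          ((Ico n (n + L)).filter S).card + ((Ico (n + L) x).filter S).card := by
        rw [h2]; exact_mod_cast card_union_le _ _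
      push_cast at h1
      linarith
    · have h1 : (((Ico n x).filter S).card : ℝ) ≤ x - n := by
        rw [← Nat.cast_sub hnx, ← Nat.card_Ico]
        exact_mod_cast card_filter_le _ _
      have h2 : (x : ℝ) ≤ n + L := by exact_mod_cast (not_le.1 hx).le
      have h3 : (n : ℝ) ≤ x := by exact_mod_cast hnx
      have h4 : η * n ≤ η * x := by gcongr
      nlinarith [mul_nonneg hρ (sub_nonneg.2 h3)]

open Classical in
theorem upper_density {f : ℕ → ℝ} (hf : LocallyAffine f) {T u v : ℝ} (hT : 0 < T) (huv : u ≤ v)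
    {Q : ℕ → Prop} (hQ : ∀ᶠ n in atTop, Q n → f n ∈ periodicInterval T u v) {η : ℝ} (hη : 0 < η) :
    ∀ᶠ N : ℕ in atTop, (((range N).filter Q).card : ℝ) ≤ ((v - u) / T + η) * N := by
  obtain ⟨n₀, h₀⟩ := eventually_atTop.1
    ((block_count hf hT huv (show (0 : ℝ) < η / 3 by positivity)).and hQ)
  have hwT : 0 ≤ (v - u) / T := div_nonneg (by linarith) hT.le
  filter_upwards [eventually_ge_atTop n₀, eventually_ge_atTop ⌈(n₀ : ℝ) / (η / 3)⌉₊] with N hN hN2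
  have h1 := greedy_count (S := fun m => f m ∈ periodicInterval T u v)
    (ρ := (v - u) / T + η / 3) (η := η / 3) (by positivity) (fun n hn => (h₀ n hn).1)
    (by positivity) le_rfl hN
  have h2 : (range N).filter Q ⊆
      range n₀ ∪ (Ico n₀ N).filter fun m => f m ∈ periodicInterval T u v := by
    intro m hm
    rw [mem_filter, mem_range] at hm
    rw [mem_union, mem_range, mem_filter, mem_Ico]
    by_cases hmn : m < n₀
    · exact Or.inl hmn
    · exact Or.inr ⟨⟨not_lt.1 hmn, hm.1⟩, (h₀ m (not_lt.1 hmn)).2 hm.2⟩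
  have h3 : (((range N).filter Q).card : ℝ) ≤
      n₀ + ((Ico n₀ N).filter fun m => f m ∈ periodicInterval T u v).card := by
    have := (card_le_card h2).trans (card_union_le _ _)
    rw [card_range] at this
    exact_mod_cast this
  have h4 : (n₀ : ℝ) ≤ η / 3 * N := by
    have := Nat.ceil_le.1 hN2
    rw [div_le_iff₀ (by positivity)] at this
    linarith
  have h5 : ((v - u) / T + η / 3) * (N - n₀) ≤ ((v - u) / T + η / 3) * N := by
    gcongr
    linarith [(Nat.cast_nonneg n₀ : (0 : ℝ) ≤ n₀)]
  linarith

-- Upper bounds suffice: `upper_density` applies to Q and to its complement, and the two bounding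
-- densities add up to 1.
open Classical in
theorem tendsto_density {f : ℕ → ℝ} (hf : LocallyAffine f) {T u v : ℝ} (huv : u ≤ v)
    (hvT : v ≤ u + T) (hT : 0 < T) {Q : ℕ → Prop}
    (hQ : ∀ᶠ n in atTop, Q n → f n ∈ periodicInterval T u v)
    (hQ' : ∀ᶠ n in atTop, ¬ Q n → f n ∈ periodicInterval T v (u + T)) :
    Tendsto (fun N : ℕ => (((range N).filter Q).card : ℝ) / N) atTop (𝓝 ((v - u) / T)) := by
  rw [Metric.tendsto_atTop']
  intro η hη
  obtain ⟨N₀, hN₀⟩ := eventually_atTop.1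
    ((upper_density hf hT huv hQ (half_pos hη)).and
      (upper_density hf hT hvT hQ' (half_pos hη)))
  refine ⟨N₀, fun N hN => ?_⟩
  obtain ⟨h1, h2⟩ := hN₀ N hN.le
  have hN0 : (0 : ℝ) < N := by exact_mod_cast (Nat.zero_le _).trans_lt hN
  have h3 : (((range N).filter Q).card : ℝ) + ((range N).filter fun n => ¬ Q n).card = N := by
    have := card_filter_add_card_filter_not (s := range N) Q
    rw [card_range] at this
    exact_mod_cast this
  have h4 : (u + T - v) / T = 1 - (v - u) / T := by field_simp; ring
  rw [h4] at h2
  rw [Real.dist_eq, abs_lt]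
  have h5 : 0 < η * N := by positivity
  generalize (v - u) / T = w at *
  have h6 : ((((range N).filter fun n => ¬ Q n).card : ℕ) : ℝ) ≤ (1 - w + η / 2) * N := by
    convert h2
  constructor
  · rw [lt_sub_iff_add_lt, lt_div_iff₀ hN0]
    nlinarith
  · rw [sub_lt_iff_lt_add, div_lt_iff₀ hN0]
    nlinarith

/-! ### From leading digits to logarithms modulo log k -/

theorem hasLeadingDigits_iff {k d a : ℕ} (hk : 2 ≤ k) (hd : 1 ≤ d) :
    HasLeadingDigits k d a ↔ ∃ m : ℕ, d * k ^ m ≤ a ∧ a < (d + 1) * k ^ m := by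
  -- Dropping the m lowest digits is division by k^m.
  have h1 : HasLeadingDigits k d a ↔ ∃ m : ℕ, a / k ^ m = d := by
    constructor
    · intro h
      obtain ⟨l, hl⟩ := h
      refine ⟨l.length, ?_⟩
      rw [Nat.self_div_pow_eq_ofDigits_drop _ _ hk, ← hl, List.drop_left, Nat.ofDigits_digits]
    · rintro ⟨m, hm⟩
      induction m generalizing a with
      | zero => simp only [pow_zero, Nat.div_one] at hm; rw [hm]; exact List.suffix_rfl
      | succ m ih =>
        rw [pow_succ', ← Nat.div_div_eq_div_mul] at hm
        have ha : 0 < a := by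
          rcases Nat.eq_zero_or_pos a with rfl | h
          · simp at hm; omega
          · exact h
        refine (ih hm).trans ?_
        rw [Nat.digits_def' hk ha]
        exact List.suffix_cons _ _
  rw [h1]
  refine exists_congr fun m => ?_
  rw [Nat.div_eq_iff (by positivity)]
  have : 0 < k ^ m := by positivity
  constructor
  · rintro ⟨h2, h3⟩
    refine ⟨h2, ?_⟩
    rw [add_mul]; omega
  · rintro ⟨h2, h3⟩
    refine ⟨h2, ?_⟩
    rw [add_mul] at h3; omega

/-- Looking left from n by K/α, f has grown by about K from a nonnegative value, and K is arbitrary.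
The tolerance 1/(2K) keeps the window to the right of n/2. -/
theorem LocallyAffine.tendsto_atTop {f : ℕ → ℝ} (hf : LocallyAffine f)
    (h0 : ∀ᶠ n in atTop, 0 ≤ f n) : Tendsto f atTop atTop := by
  obtain ⟨n₀, hn₀⟩ := eventually_atTop.1 h0
  rw [Filter.tendsto_atTop]
  intro B
  set K := max B 0 + 3 with hK
  have hK0 : 0 < K := by positivity
  filter_upwards [hf K (1 / (2 * K)) hK0 (by positivity), eventually_ge_atTop (2 * n₀)] with n hn hn2
  obtain ⟨α, hα, hα1, hαn, hwin⟩ := hn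
  have hL : (⌊K / α⌋₊ : ℝ) ≤ K / α := Nat.floor_le (by positivity)
  have hL2 : K / α < ⌊K / α⌋₊ + 1 := Nat.lt_floor_add_one _
  have hKn : K / α ≤ n / 2 := by
    calc K / α = K * (1 / α) := by ring
      _ ≤ K * (1 / (2 * K) * n) := by gcongr
      _ = n / 2 := by field_simp
  have hnn : (0 : ℝ) ≤ n := Nat.cast_nonneg n
  have hLn : ⌊K / α⌋₊ ≤ n := by
    have : (⌊K / α⌋₊ : ℝ) ≤ n := by linarith
    exact_mod_cast this
  have h1 := hwin (n - ⌊K / α⌋₊) (by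
    rw [Nat.cast_sub hLn, abs_sub_comm, sub_sub_cancel, abs_of_nonneg (by positivity)]; exact hL)
  rw [Nat.cast_sub hLn, abs_le] at h1
  have h2 : 0 ≤ f (n - ⌊K / α⌋₊) := by
    apply hn₀
    have h3 : (n₀ : ℝ) ≤ ((n - ⌊K / α⌋₊ : ℕ) : ℝ) := by
      rw [Nat.cast_sub hLn]
      have : (2 : ℝ) * n₀ ≤ n := by exact_mod_cast hn2
      linarith
    exact_mod_cast h3
  have h4 : K - α ≤ α * ⌊K / α⌋₊ := by
    rw [div_lt_iff₀ hα] at hL2; linarith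
  have h5 : 1 / (2 * K) ≤ 1 := by
    rw [div_le_one (by positivity)]
    have := le_max_right B 0
    linarith
  have h6 := le_max_left B 0
  linarith [h1.2]

/-- A sequence of positive integers whose logarithm is locally affine is Benford. -/
theorem isBenford_of_locallyAffine {a : ℕ → ℕ} (ha : ∀ᶠ n in atTop, a n ≠ 0)
    (hf : LocallyAffine fun n => Real.log (a n)) : IsBenford a := by
  classical
  intro k hk d hd
  have hk0 : (0 : ℝ) < k := by positivity
  have hk1 : (1 : ℝ) < k := by exact_mod_cast hk
  have hd0 : (0 : ℝ) < d := by exact_mod_cast hd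
  have hT : 0 < Real.log k := Real.log_pos hk1
  have huv : Real.log d ≤ Real.log (d + 1) := Real.log_le_log hd0 (by linarith)
  have hvT : Real.log (d + 1) ≤ Real.log d + Real.log k := by
    rw [← Real.log_mul hd0.ne' hk0.ne']
    refine Real.log_le_log (by linarith) ?_
    have h1 : (1 : ℝ) ≤ d := by exact_mod_cast hd
    have h2 : (2 : ℝ) ≤ k := by exact_mod_cast hk
    nlinarith
  have htop := hf.tendsto_atTop (Eventually.of_forall fun n => Real.log_natCast_nonneg _)
  have hlogpow : ∀ (c : ℝ) (j : ℤ), 0 < c → Real.log c + j * Real.log k = Real.log (c * k ^ j) := by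
    intro c j hc
    rw [Real.log_mul hc.ne' (zpow_pos hk0 j).ne', Real.log_zpow]
  have hQ : ∀ᶠ n in atTop, HasLeadingDigits k d (a n) →
      Real.log (a n) ∈ periodicInterval (Real.log k) (Real.log d) (Real.log (d + 1)) := by
    filter_upwards [ha] with n hn h
    obtain ⟨m, h1, h2⟩ := (hasLeadingDigits_iff hk hd).1 h
    refine ⟨m, ?_⟩
    have han : (0 : ℝ) < a n := by exact_mod_cast Nat.pos_of_ne_zero hn
    rw [hlogpow _ _ hd0, hlogpow _ _ (by linarith), zpow_natCast]
    exact ⟨Real.log_le_log (by positivity) (by exact_mod_cast h1),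
      Real.log_lt_log han (by exact_mod_cast h2)⟩
  have hQ' : ∀ᶠ n in atTop, ¬ HasLeadingDigits k d (a n) →
      Real.log (a n) ∈
        periodicInterval (Real.log k) (Real.log (d + 1)) (Real.log d + Real.log k) := by
    filter_upwards [ha, htop.eventually_ge_atTop (Real.log (d + 1))] with n hn hge h
    have han : (0 : ℝ) < a n := by exact_mod_cast Nat.pos_of_ne_zero hn
    set j : ℤ := ⌊(Real.log (a n) - Real.log d) / Real.log k⌋ with hj
    have hj1 : Real.log d + j * Real.log k ≤ Real.log (a n) := by
      have := Int.floor_le ((Real.log (a n) - Real.log d) / Real.log k)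
      rw [le_div_iff₀ hT] at this
      linarith
    have hj2 : Real.log (a n) < Real.log d + Real.log k + j * Real.log k := by
      have := Int.lt_floor_add_one ((Real.log (a n) - Real.log d) / Real.log k)
      rw [div_lt_iff₀ hT] at this
      linarith
    refine ⟨j, ?_, hj2⟩
    by_contra hcon
    rw [not_le] at hcon
    apply h
    rw [hasLeadingDigits_iff hk hd]
    -- The growth of a(n) is needed here: a leading block d requires an exponent m ≥ 0, whereas the
    -- interval modulo log k also admits negative j.
    have hj0 : 0 ≤ j := by
      rw [hj, Int.floor_nonneg]
      exact div_nonneg (by linarith) hT.le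
    obtain ⟨m, hm⟩ := Int.eq_ofNat_of_zero_le hj0
    refine ⟨m, ?_⟩
    rw [hlogpow _ _ hd0, hm, zpow_natCast] at hj1
    rw [hlogpow _ _ (by linarith), hm, zpow_natCast] at hcon
    have c1 := (Real.log_le_log_iff (by positivity) han).1 hj1
    have c2 := (Real.log_lt_log_iff han (by positivity)).1 hcon
    exact ⟨by exact_mod_cast c1, by exact_mod_cast c2⟩
  have hmain := tendsto_density hf huv hvT hT hQ hQ'
  have hlim : (Real.log (d + 1) - Real.log d) / Real.log k =
      Real.logb k ((d : ℝ) + 1) - Real.logb k d := by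
    simp only [Real.logb]; ring
  rw [hlim] at hmain
  -- There are ⌊x⌋ + 1 indices n ≤ x, counting 0, while the frequency divides by x.
  have hcomp : Tendsto (fun x : ℝ => ⌊x⌋₊ + 1) atTop atTop :=
    (tendsto_add_atTop_nat 1).comp (tendsto_nat_floor_atTop)
  have h1 := hmain.comp hcomp
  have h2 : Tendsto (fun x : ℝ => ((⌊x⌋₊ + 1 : ℕ) : ℝ) / x) atTop (𝓝 1) := by
    have h3 := (tendsto_nat_floor_div_atTop (R := ℝ)).add (tendsto_inv_atTop_zero (𝕜 := ℝ))
    rw [add_zero] at h3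
    refine h3.congr fun x => ?_
    push_cast
    rw [add_div, one_div]
  have h3 := h1.mul h2
  rw [mul_one] at h3
  refine h3.congr' ?_
  filter_upwards [eventually_gt_atTop 0] with x hx
  have hpos : (0 : ℝ) < ((⌊x⌋₊ + 1 : ℕ) : ℝ) := by positivity
  have hset : {n : ℕ | (n : ℝ) ≤ x ∧ HasLeadingDigits k d (a n)} =
      ((range (⌊x⌋₊ + 1)).filter fun n => HasLeadingDigits k d (a n) : Finset ℕ) := by
    ext n
    simp [Nat.le_floor_iff hx.le]
  simp only [Function.comp]
  rw [benfordFreq, hset, Set.ncard_coe_finset]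
  field_simp

theorem LocallyAffine.comp_add {f : ℕ → ℝ} (hf : LocallyAffine f) (c : ℕ) :
    LocallyAffine fun n => f (n + c) := by
  intro K ε hK hε
  have h := (tendsto_add_atTop_nat c).eventually (hf K (ε / 2) hK (half_pos hε))
  filter_upwards [h, eventually_ge_atTop c] with n hn hnc
  obtain ⟨α, h1, h2, h3, h4⟩ := hn
  refine ⟨α, h1, h2.trans (by linarith), h3.trans ?_, fun m hm => ?_⟩
  · have : (c : ℝ) ≤ n := by exact_mod_cast hnc
    push_cast
    nlinarith
  · have h5 := h4 (m + c) (by push_cast; simpa using hm)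
    push_cast at h5
    rw [add_sub_add_right_eq_sub] at h5
    exact h5.trans (by linarith)

theorem LocallyAffine.congr {f g : ℕ → ℝ} (hf : LocallyAffine f) (h : f =ᶠ[atTop] g) :
    LocallyAffine g := by
  obtain ⟨n₀, hn₀⟩ := eventually_atTop.1 h
  intro K ε hK hε
  -- The second entry forces K/α ≤ n/2, so the whole window lies where f and g agree.
  have hε' : 0 < min ε (1 / (2 * K)) := lt_min hε (by positivity)
  filter_upwards [hf K _ hK hε', eventually_ge_atTop (2 * n₀)] with n hn hn2
  obtain ⟨α, h1, h2, h3, h4⟩ := hn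
  have hnn : (0 : ℝ) ≤ n := Nat.cast_nonneg n
  refine ⟨α, h1, h2.trans (min_le_left _ _), h3.trans (by gcongr; exact min_le_left _ _),
    fun m hm => ?_⟩
  have hKn : K / α ≤ n / 2 := by
    calc K / α = K * (1 / α) := by ring
      _ ≤ K * (1 / (2 * K) * n) := by
        gcongr; exact h3.trans (by gcongr; exact min_le_right _ _)
      _ = n / 2 := by field_simp
  have hm0 : n₀ ≤ m := by
    have h5 := (abs_le.1 hm).1
    have : (2 : ℝ) * n₀ ≤ n := by exact_mod_cast hn2
    have : (n₀ : ℝ) ≤ m := by linarith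
    exact_mod_cast this
  rw [← hn₀ n (by omega), ← hn₀ m hm0]
  exact (h4 m hm).trans (min_le_left _ _)

end Benford

namespace PartitionAsymptotics

open Filter Topology Finset

/-- The weights in `log ∏_{p m} (1 - q ^ m)⁻¹ = ∑ wt (k, m) q ^ (k m)`. -/
noncomputable def wt (p : ℕ → Prop) [DecidablePred p] (i : ℕ × ℕ) : ℝ :=
  if p i.2 then 1 / (i.1 : ℝ) else 0

/-- The exponents in `log ∏_{p m} (1 - q ^ m)⁻¹ = ∑ wt (k, m) q ^ (k m)`. -/
def sz (i : ℕ × ℕ) : ℕ := i.1 * i.2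

/-! ### Moments of the weights -/

section Moments

variable {p : ℕ → Prop} [DecidablePred p]

theorem wt_nonneg (i : ℕ × ℕ) : 0 ≤ wt p i := by
  unfold wt; split_ifs <;> positivity

theorem wt_mul_exp_le (h0 : ¬ p 0) (β : ℝ) (k m : ℕ) :
    wt p (k, m) * Real.exp (-β * sz (k, m)) ≤
      1 / (k : ℝ) * (if m = 0 then 0 else Real.exp (-β * k) ^ m) := by
  unfold wt sz
  rcases Nat.eq_zero_or_pos m with rfl | hm
  · simp [h0]
  · have h1 : Real.exp (-β * k) ^ m = Real.exp (-β * (k * m : ℕ)) := by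
      rw [← Real.exp_nat_mul]; congr 1; push_cast; ring
    rw [if_neg hm.ne', h1]
    gcongr
    dsimp only
    split_ifs
    · exact le_rfl
    · positivity

theorem hasSum_pow_pos {r : ℝ} (h0 : 0 ≤ r) (h1 : r < 1) :
    HasSum (fun m : ℕ => if m = 0 then 0 else r ^ m) ((1 - r)⁻¹ - 1) := by
  have := (hasSum_geometric_of_lt_one h0 h1).update 0 0
  simp only [pow_zero] at this
  rw [show (1 - r)⁻¹ - 1 = 0 - 1 + (1 - r)⁻¹ by ring]
  refine this.congr_fun fun m => ?_
  by_cases hm : m = 0 <;> simp [hm, Function.update]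

theorem inv_one_sub_exp_le {y : ℝ} (hy : 0 < y) : (1 - Real.exp (-y))⁻¹ - 1 ≤ 1 / y := by
  have h1 : y + 1 ≤ Real.exp y := Real.add_one_le_exp y
  have h2 : Real.exp (-y) = (Real.exp y)⁻¹ := Real.exp_neg y
  have h3 : 0 < Real.exp y - 1 := by linarith
  have h4 : (1 - Real.exp (-y))⁻¹ - 1 = 1 / (Real.exp y - 1) := by
    rw [h2]
    have : Real.exp y ≠ 0 := (Real.exp_pos y).ne'
    have : 1 - (Real.exp y)⁻¹ ≠ 0 := by
      have : 1 - (Real.exp y)⁻¹ = (Real.exp y - 1) / Real.exp y := by field_simp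
      rw [this]; positivity
    field_simp
    ring
  rw [h4]
  exact one_div_le_one_div_of_le hy (by linarith)

/-- For fixed k the sum over m ≥ 1 of e^(-βkm) is at most 1/(βk). The remaining sum over k converges
like ∑ 1/k². -/
theorem summable_wt_exp (h0 : ¬ p 0) {β : ℝ} (hβ : 0 < β) :
    Summable (fun i => wt p i * Real.exp (-β * sz i)) ∧
      ∑' i, wt p i * Real.exp (-β * sz i) ≤ (∑' k : ℕ, 1 / (k : ℝ) ^ 2) / β := by
  set F : ℕ → ℕ → ℝ := fun k m => 1 / (k : ℝ) * (if m = 0 then 0 else Real.exp (-β * k) ^ m) with hF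
  have hF0 : ∀ k m, 0 ≤ F k m := by
    intro k m
    simp only [hF]
    split_ifs <;> positivity
  have hFs : ∀ k, Summable (F k) ∧ ∑' m, F k m ≤ 1 / (k : ℝ) ^ 2 / β := by
    intro k
    -- The row k = 0 vanishes because 1/0 = 0, so summing over all of ℕ × ℕ is harmless.
    rcases Nat.eq_zero_or_pos k with rfl | hk
    · simp [hF, summable_zero]
    · have hk' : (0 : ℝ) < k := by exact_mod_cast hk
      have hlt : Real.exp (-β * k) < 1 := by
        rw [Real.exp_lt_one_iff]; nlinarith
      have h1 := (hasSum_pow_pos (Real.exp_pos _).le hlt).mul_left (1 / (k : ℝ))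
      refine ⟨h1.summable, ?_⟩
      rw [h1.tsum_eq]
      have h2 := inv_one_sub_exp_le (mul_pos hβ hk')
      rw [show -(β * (k : ℝ)) = -β * k by ring] at h2
      calc 1 / (k : ℝ) * ((1 - Real.exp (-β * k))⁻¹ - 1) ≤ 1 / (k : ℝ) * (1 / (β * k)) := by gcongr
        _ = _ := by field_simp
  have hk2 : Summable fun k : ℕ => 1 / (k : ℝ) ^ 2 := Real.summable_one_div_nat_pow.2 (by norm_num)
  have hS : Summable fun k => ∑' m, F k m :=
    Summable.of_nonneg_of_le (fun k => tsum_nonneg (hF0 k)) (fun k => (hFs k).2) (hk2.div_const β)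
  have hF2 : Summable fun i : ℕ × ℕ => F i.1 i.2 :=
    (summable_prod_of_nonneg (fun i => hF0 i.1 i.2)).2 ⟨fun k => (hFs k).1, hS⟩
  have hle : ∀ i : ℕ × ℕ, wt p i * Real.exp (-β * sz i) ≤ F i.1 i.2 := fun i =>
    wt_mul_exp_le h0 β i.1 i.2
  have hsum := Summable.of_nonneg_of_le
    (fun i => mul_nonneg (wt_nonneg (p := p) i) (Real.exp_pos (-β * sz i)).le) hle hF2
  refine ⟨hsum, ?_⟩
  calc ∑' i, wt p i * Real.exp (-β * sz i) ≤ ∑' i : ℕ × ℕ, F i.1 i.2 := hsum.tsum_le_tsum hle hF2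
    _ = ∑' k, ∑' m, F k m := hF2.tsum_prod
    _ ≤ ∑' k : ℕ, 1 / (k : ℝ) ^ 2 / β := hS.tsum_le_tsum (fun k => (hFs k).2) (hk2.div_const β)
    _ = _ := by rw [tsum_div_const]

/-- Half of the exponential absorbs the power, by t^s / s! ≤ e^t with t = αy/2. -/
theorem pow_mul_exp_le (s : ℕ) {α y : ℝ} (hα : 0 < α) (hy : 0 ≤ y) :
    y ^ s * Real.exp (-α * y) ≤ (s.factorial * 2 ^ s / α ^ s) * Real.exp (-(α / 2) * y) := by
  have h1 := Real.pow_div_factorial_le_exp (α / 2 * y) (by positivity) s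
  rw [div_le_iff₀ (by positivity), mul_pow, div_pow] at h1
  have h2 : Real.exp (-(α / 2) * y) = Real.exp (α / 2 * y) * Real.exp (-α * y) := by
    rw [← Real.exp_add]; congr 1; ring
  rw [h2, ← mul_assoc]
  gcongr
  have h3 : y ^ s = (2 ^ s / α ^ s) * (α ^ s / 2 ^ s * y ^ s) := by field_simp
  rw [h3]
  calc (2 ^ s / α ^ s) * (α ^ s / 2 ^ s * y ^ s) ≤
      (2 ^ s / α ^ s) * (Real.exp (α / 2 * y) * s.factorial) := by gcongr
    _ = _ := by ring

theorem summable_moment (h0 : ¬ p 0) (s : ℕ) {α : ℝ} (hα : 0 < α) :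
    Summable (fun i => wt p i * Real.exp (-α * sz i) * (sz i : ℝ) ^ s) ∧
      ∑' i, wt p i * Real.exp (-α * sz i) * (sz i : ℝ) ^ s ≤
        (s.factorial * 2 ^ (s + 1) * ∑' k : ℕ, 1 / (k : ℝ) ^ 2) / α ^ (s + 1) := by
  obtain ⟨h1, h2⟩ := summable_wt_exp h0 (half_pos hα)
  have hle : ∀ i : ℕ × ℕ, wt p i * Real.exp (-α * sz i) * (sz i : ℝ) ^ s ≤
      (s.factorial * 2 ^ s / α ^ s) * (wt p i * Real.exp (-(α / 2) * sz i)) := by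
    intro i
    have := mul_le_mul_of_nonneg_left (pow_mul_exp_le s hα (Nat.cast_nonneg (sz i)))
      (wt_nonneg (p := p) i)
    linarith
  have hs := Summable.of_nonneg_of_le (fun i => mul_nonneg (mul_nonneg (wt_nonneg (p := p) i)
    (Real.exp_pos (-α * sz i)).le) (by positivity)) hle (h1.mul_left _)
  refine ⟨hs, (hs.tsum_le_tsum hle (h1.mul_left _)).trans ?_⟩
  rw [tsum_mul_left]
  calc _ ≤ (s.factorial * 2 ^ s / α ^ s) * ((∑' k : ℕ, 1 / (k : ℝ) ^ 2) / (α / 2)) := by gcongr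
    _ = _ := by rw [pow_succ, pow_succ]; field_simp

end Moments

/-! ### The generating function as an analytic function in the unit disc -/

section GeneratingFunction

open PowerSeries

/-- `HasValue f q v`: the power series `f` converges absolutely at `q`, to `v`. -/
def HasValue (f : ℂ⟦X⟧) (q v : ℂ) : Prop :=
  (Summable fun n => ‖coeff n f * q ^ n‖) ∧ ∑' n, coeff n f * q ^ n = v

theorem HasValue.one (q : ℂ) : HasValue 1 q 1 := by
  have h : ∀ n, coeff n (1 : ℂ⟦X⟧) * q ^ n = if n = 0 then 1 else 0 := by
    intro n
    rw [coeff_one]; split_ifs with h <;> simp [h]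
  constructor
  · refine summable_of_ne_finset_zero (s := {0}) fun n hn => ?_
    rw [h]; simp at hn; simp [hn]
  · simp_rw [h]; simp

theorem HasValue.mul {f g : ℂ⟦X⟧} {q v w : ℂ} (hf : HasValue f q v) (hg : HasValue g q w) :
    HasValue (f * g) q (v * w) := by
  set F : ℕ → ℂ := fun n => coeff n f * q ^ n with hF
  set G : ℕ → ℂ := fun n => coeff n g * q ^ n with hG
  have h : ∀ n, coeff n (f * g) * q ^ n = ∑ kl ∈ antidiagonal n, F kl.1 * G kl.2 := by
    intro n
    simp only [hF, hG]
    rw [coeff_mul, sum_mul]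
    refine sum_congr rfl fun kl hkl => ?_
    rw [← mem_antidiagonal.1 hkl, pow_add]; ring
  constructor
  · simp_rw [h]
    exact summable_norm_sum_mul_antidiagonal_of_summable_norm (f := F) (g := G) hf.1 hg.1
  · simp_rw [h]
    rw [← tsum_mul_tsum_eq_tsum_sum_antidiagonal_of_summable_norm (f := F) (g := G) hf.1 hg.1,
      ← hf.2, ← hg.2]

theorem HasValue.prod {ι : Type*} (s : Finset ι) {f : ι → ℂ⟦X⟧} {v : ι → ℂ} {q : ℂ}
    (h : ∀ i ∈ s, HasValue (f i) q (v i)) : HasValue (∏ i ∈ s, f i) q (∏ i ∈ s, v i) := by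
  classical
  induction s using Finset.induction_on with
  | empty => simpa using HasValue.one q
  | insert a s ha ih =>
    rw [prod_insert ha, prod_insert ha]
    exact (h a (mem_insert_self a s)).mul (ih fun i hi => h i (mem_insert_of_mem hi))

theorem coeff_tsum_X_pow {m : ℕ} (hm : 0 < m) (n : ℕ) :
    coeff n (∑' j : ℕ, (X : ℂ⟦X⟧) ^ (m * j)) = if m ∣ n then 1 else 0 := by
  have h : HasSum (fun j : ℕ => (X : ℂ⟦X⟧) ^ (m * j))
      (PowerSeries.mk fun n => if m ∣ n then (1 : ℂ) else 0) := by
    rw [PowerSeries.WithPiTopology.hasSum_iff_hasSum_coeff]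
    intro d
    rw [coeff_mk]
    by_cases hd : m ∣ d
    · obtain ⟨c, rfl⟩ := hd
      rw [if_pos (dvd_mul_right m c)]
      have : (fun j : ℕ => coeff (m * c) ((X : ℂ⟦X⟧) ^ (m * j))) =
          fun j => if j = c then 1 else 0 := by
        funext j
        rw [coeff_X_pow]
        refine if_congr ?_ rfl rfl
        rw [mul_right_inj' hm.ne', eq_comm]
      rw [this]
      exact hasSum_ite_eq c 1
    · rw [if_neg hd]
      have : (fun j : ℕ => coeff d ((X : ℂ⟦X⟧) ^ (m * j))) = fun j => 0 := by
        funext j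
        rw [coeff_X_pow, if_neg]
        rintro rfl
        exact hd (dvd_mul_right m j)
      rw [this]
      exact hasSum_zero
  rw [h.tsum_eq, coeff_mk]

theorem HasValue.geometric {m : ℕ} (hm : 0 < m) {q : ℂ} (hq : ‖q‖ < 1) :
    HasValue (∑' j : ℕ, (X : ℂ⟦X⟧) ^ (m * j)) q (1 - q ^ m)⁻¹ := by
  have hinj : Function.Injective fun j : ℕ => m * j := fun a b h => by
    simpa [hm.ne'] using h
  have hqm : ‖q ^ m‖ < 1 := by rw [norm_pow]; exact pow_lt_one₀ (norm_nonneg q) hq hm.ne'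
  have hzero : ∀ n ∉ Set.range fun j : ℕ => m * j,
      coeff n (∑' j : ℕ, (X : ℂ⟦X⟧) ^ (m * j)) * q ^ n = 0 := by
    intro n hn
    rw [coeff_tsum_X_pow hm, if_neg, zero_mul]
    rintro ⟨c, rfl⟩
    exact hn ⟨c, rfl⟩
  have hcomp : (fun n => coeff n (∑' j : ℕ, (X : ℂ⟦X⟧) ^ (m * j)) * q ^ n) ∘ (fun j : ℕ => m * j) =
      fun j => (q ^ m) ^ j := by
    funext j
    simp only [Function.comp]
    rw [coeff_tsum_X_pow hm, if_pos (dvd_mul_right m j), one_mul, pow_mul]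
  constructor
  · refine (hinj.summable_iff fun n hn => by rw [hzero n hn, norm_zero]).1 ?_
    have : (fun n => ‖coeff n (∑' j : ℕ, (X : ℂ⟦X⟧) ^ (m * j)) * q ^ n‖) ∘ (fun j : ℕ => m * j) =
        fun j => ‖(q ^ m) ^ j‖ := by
      funext j
      exact congrArg norm (congrFun hcomp j)
    rw [this]
    simp_rw [norm_pow (q ^ m)]
    exact summable_geometric_of_lt_one (norm_nonneg _) hqm
  · have := (hinj.hasSum_iff hzero).1 (by rw [hcomp]; exact hasSum_geometric_of_norm_lt_one hqm)
    exact this.tsum_eq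

variable (p : ℕ → Prop) [DecidablePred p]

/-- The number of partitions of `n` with all parts satisfying `p`. -/
def partsCount (n : ℕ) : ℕ := (Nat.Partition.restricted n p).card

/-- With parts below N the product is finite, so the formal identity can be evaluated factor by
factor. -/
theorem hasValue_bounded (h0 : ¬ p 0) (N : ℕ) {q : ℂ} (hq : ‖q‖ < 1) :
    HasValue (PowerSeries.mk fun n => (partsCount (fun i => p i ∧ i < N) n : ℂ)) q
      (∏ m ∈ range N, if p m then (1 - q ^ m)⁻¹ else 1) := by
  have h := Nat.Partition.hasProd_powerSeriesMk_card_restricted ℂ (fun i => p i ∧ i < N)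
  have h2 : HasProd
      (fun i => if p (i + 1) ∧ i + 1 < N then ∑' j : ℕ, (X : ℂ⟦X⟧) ^ ((i + 1) * j) else 1)
      (∏ i ∈ range (N - 1), if p (i + 1) ∧ i + 1 < N then
        ∑' j : ℕ, (X : ℂ⟦X⟧) ^ ((i + 1) * j) else 1) :=
    hasProd_prod_of_ne_finset_one fun i hi => by
      rw [if_neg]
      rw [mem_range] at hi
      omega
  have h3 := h.unique h2
  have h4 : (PowerSeries.mk fun n => (partsCount (fun i => p i ∧ i < N) n : ℂ)) =
      ∏ i ∈ range (N - 1), if p (i + 1) ∧ i + 1 < N then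
        ∑' j : ℕ, (X : ℂ⟦X⟧) ^ ((i + 1) * j) else 1 := h3
  have h5 : (∏ m ∈ range N, if p m then (1 - q ^ m)⁻¹ else 1) =
      ∏ i ∈ range (N - 1), if p (i + 1) ∧ i + 1 < N then (1 - q ^ (i + 1))⁻¹ else 1 := by
    rcases N with _ | N
    · simp
    · rw [prod_range_succ', if_neg h0, mul_one, Nat.add_sub_cancel]
      refine prod_congr rfl fun i hi => ?_
      have : i + 1 < N + 1 := by simpa using hi
      simp [this]
  rw [h4, h5]
  refine HasValue.prod _ fun i _ => ?_
  split_ifs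
  · exact HasValue.geometric (Nat.succ_pos i) hq
  · exact HasValue.one q

theorem partsCount_bounded_le (N n : ℕ) :
    partsCount (fun i => p i ∧ i < N) n ≤ partsCount p n := by
  refine card_le_card fun x hx => ?_
  simp only [Nat.Partition.restricted, mem_filter, mem_univ, true_and] at hx ⊢
  exact fun i hi => (hx i hi).1

theorem partsCount_bounded_eq {N n : ℕ} (h : n < N) :
    partsCount (fun i => p i ∧ i < N) n = partsCount p n := by
  refine le_antisymm (partsCount_bounded_le p N n) (card_le_card fun x hx => ?_)
  simp only [Nat.Partition.restricted, mem_filter, mem_univ, true_and] at hx ⊢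
  intro i hi
  refine ⟨hx i hi, lt_of_le_of_lt ?_ h⟩
  exact (Multiset.le_sum_of_mem hi).trans_eq x.parts_sum

/-- The point `exp (-α + θ i)`. -/
noncomputable def pt (α θ : ℝ) : ℂ := Complex.exp (-α + θ * Complex.I)

theorem norm_pt (α θ : ℝ) : ‖pt α θ‖ = Real.exp (-α) := by
  rw [pt, Complex.norm_exp]; simp

theorem norm_pt_lt_one {α : ℝ} (hα : 0 < α) (θ : ℝ) : ‖pt α θ‖ < 1 := by
  rw [norm_pt]; simpa using hα

variable {p}

theorem summable_wt_pt (h0 : ¬ p 0) {α : ℝ} (hα : 0 < α) (θ : ℝ) :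
    Summable fun i => (wt p i : ℂ) * pt α θ ^ sz i := by
  refine Summable.of_norm ((summable_wt_exp h0 hα).1.congr fun i => ?_)
  rw [norm_mul, norm_pow, norm_pt, Complex.norm_real, Real.norm_of_nonneg (wt_nonneg i),
    ← Real.exp_nat_mul]
  congr 2; ring

/-- Summing over k first gives -log(1 - q^m) for each admissible m. The logarithms are exponentiated
again, so no branch problem arises. -/
theorem tendsto_prod_exp (h0 : ¬ p 0) {α : ℝ} (hα : 0 < α) (θ : ℝ) :
    Tendsto (fun N => ∏ m ∈ range N, if p m then (1 - pt α θ ^ m)⁻¹ else 1) atTop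
      (𝓝 (Complex.exp (∑' i, (wt p i : ℂ) * pt α θ ^ sz i))) := by
  have h1 := (Equiv.prodComm ℕ ℕ).hasSum_iff.2 (summable_wt_pt h0 hα θ).hasSum
  have hfib : ∀ m : ℕ, HasSum (fun k : ℕ => ((fun i => (wt p i : ℂ) * pt α θ ^ sz i) ∘
      (Equiv.prodComm ℕ ℕ)) (m, k)) (if p m then -Complex.log (1 - pt α θ ^ m) else 0) := by
    intro m
    by_cases hm : p m
    · have hm0 : m ≠ 0 := fun h => h0 (h ▸ hm)
      have hlt : ‖pt α θ ^ m‖ < 1 := by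
        rw [norm_pow]; exact pow_lt_one₀ (norm_nonneg _) (norm_pt_lt_one hα θ) hm0
      rw [if_pos hm]
      refine (Complex.hasSum_taylorSeries_neg_log hlt).congr_fun fun k => ?_
      have hw : wt p (k, m) = 1 / (k : ℝ) := if_pos hm
      change (wt p (k, m) : ℂ) * pt α θ ^ (k * m) = _
      rw [hw]
      push_cast
      rw [← pow_mul, mul_comm m k]; ring
    · rw [if_neg hm]
      refine hasSum_zero.congr_fun fun k => ?_
      simp [wt, hm]
  have h2 := (h1.prod_fiberwise hfib).tendsto_sum_nat
  refine ((Complex.continuous_exp.tendsto _).comp h2).congr fun N => ?_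
  simp only [Function.comp]
  rw [Complex.exp_sum]
  refine prod_congr rfl fun m _ => ?_
  by_cases hm : p m
  · have hm0 : m ≠ 0 := fun h => h0 (h ▸ hm)
    have hlt : ‖pt α θ ^ m‖ < 1 := by
      rw [norm_pow]; exact pow_lt_one₀ (norm_nonneg _) (norm_pt_lt_one hα θ) hm0
    have hne : 1 - pt α θ ^ m ≠ 0 := by
      intro h
      rw [sub_eq_zero] at h
      rw [← h] at hlt
      simp at hlt
    rw [if_pos hm, if_pos hm, Complex.exp_neg, Complex.exp_log hne]
  · simp [hm]

/-- Terms below N are unchanged when parts are restricted to be less than N, so the partial sum is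
at most the truncated product at θ = 0. These products converge, hence are bounded. -/
theorem summable_partsCount (h0 : ¬ p 0) {α : ℝ} (hα : 0 < α) :
    Summable fun n => (partsCount p n : ℝ) * Real.exp (-α) ^ n := by
  have hx0 : 0 ≤ Real.exp (-α) := (Real.exp_pos _).le
  have hptx : pt α 0 = (Real.exp (-α) : ℝ) := by simp [pt]
  have hb := (tendsto_prod_exp h0 hα 0).norm.bddAbove_range
  obtain ⟨B, hB⟩ := hb
  refine summable_of_sum_range_le (c := B) (fun n => by positivity) fun N => ?_
  obtain ⟨hs, hv⟩ := hasValue_bounded p h0 N (norm_pt_lt_one hα 0)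
  have hterm : ∀ n, ‖coeff n (PowerSeries.mk fun n => (partsCount (fun i => p i ∧ i < N) n : ℂ)) *
      pt α 0 ^ n‖ = (partsCount (fun i => p i ∧ i < N) n : ℝ) * Real.exp (-α) ^ n := by
    intro n
    rw [coeff_mk, norm_mul, norm_pow, norm_pt, Complex.norm_natCast]
  have hs' : Summable fun n => (partsCount (fun i => p i ∧ i < N) n : ℝ) * Real.exp (-α) ^ n :=
    hs.congr hterm
  have h1 : ((∑' n, (partsCount (fun i => p i ∧ i < N) n : ℝ) * Real.exp (-α) ^ n : ℝ) : ℂ) =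
      ∏ m ∈ range N, if p m then (1 - pt α 0 ^ m)⁻¹ else 1 := by
    rw [← hv, Complex.ofReal_tsum]
    refine tsum_congr fun n => ?_
    rw [coeff_mk, hptx]; push_cast; ring
  calc ∑ n ∈ range N, (partsCount p n : ℝ) * Real.exp (-α) ^ n =
      ∑ n ∈ range N, (partsCount (fun i => p i ∧ i < N) n : ℝ) * Real.exp (-α) ^ n := by
        refine sum_congr rfl fun n hn => ?_
        rw [partsCount_bounded_eq p (mem_range.1 hn)]
    _ ≤ ∑' n, (partsCount (fun i => p i ∧ i < N) n : ℝ) * Real.exp (-α) ^ n :=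
        hs'.sum_le_tsum _ fun n _ => by positivity
    _ ≤ ‖∏ m ∈ range N, if p m then (1 - pt α 0 ^ m)⁻¹ else 1‖ := by
        rw [← h1, Complex.norm_real]; exact le_abs_self _
    _ ≤ B := hB ⟨N, rfl⟩

/-- The generating function of restricted partitions inside the unit disc. -/
theorem tsum_partsCount (h0 : ¬ p 0) {α : ℝ} (hα : 0 < α) (θ : ℝ) :
    ∑' n, (partsCount p n : ℂ) * pt α θ ^ n =
      Complex.exp (∑' i, (wt p i : ℂ) * pt α θ ^ sz i) := by
  refine tendsto_nhds_unique ?_ (tendsto_prod_exp h0 hα θ)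
  have h1 : Tendsto (fun N => ∑' n, (partsCount (fun i => p i ∧ i < N) n : ℂ) * pt α θ ^ n) atTop
      (𝓝 (∑' n, (partsCount p n : ℂ) * pt α θ ^ n)) := by
    refine tendsto_tsum_of_dominated_convergence (summable_partsCount h0 hα) (fun n => ?_) ?_
    · refine tendsto_atTop_of_eventually_const (i₀ := n + 1) fun N hN => ?_
      rw [partsCount_bounded_eq p (by omega)]
    · refine Eventually.of_forall fun N n => ?_
      rw [norm_mul, norm_pow, norm_pt, Complex.norm_natCast]
      gcongr
      exact partsCount_bounded_le p N n
  refine h1.congr fun N => ?_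
  rw [← (hasValue_bounded p h0 N (norm_pt_lt_one hα θ)).2]
  simp_rw [coeff_mk]

end GeneratingFunction

end PartitionAsymptotics

namespace PartitionAsymptotics

open Filter Topology Finset

/-! ### Coefficient extraction on a circle -/

section Fourier

theorem integral_exp_int (k : ℤ) :
    ∫ θ in (-Real.pi)..Real.pi, Complex.exp (k * Complex.I * θ) =
      if k = 0 then (2 * Real.pi : ℂ) else 0 := by
  split_ifs with h
  · subst h
    simp
    ring
  · have hc : (k : ℂ) * Complex.I ≠ 0 := mul_ne_zero (by exact_mod_cast h) Complex.I_ne_zero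
    rw [integral_exp_mul_complex hc]
    have : Complex.exp (k * Complex.I * (Real.pi : ℝ)) =
        Complex.exp (k * Complex.I * ((-Real.pi : ℝ) : ℂ)) := by
      rw [Complex.exp_eq_exp_iff_exists_int]
      exact ⟨k, by push_cast; ring⟩
    rw [this, sub_self, zero_div]

theorem pt_pow (α θ : ℝ) (n : ℕ) :
    pt α θ ^ n = (Real.exp (-α * n) : ℂ) * Complex.exp (n * Complex.I * θ) := by
  rw [pt, ← Complex.exp_nat_mul, Complex.ofReal_exp, ← Complex.exp_add]
  congr 1
  push_cast
  ring

/-- Cauchy's formula for the coefficients of the generating function. -/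
theorem integral_partsCount {p : ℕ → Prop} [DecidablePred p] (h0 : ¬ p 0) {α : ℝ} (hα : 0 < α)
    (N : ℕ) :
    ∫ θ in (-Real.pi)..Real.pi, Complex.exp (∑' i, (wt p i : ℂ) * pt α θ ^ sz i) *
      Complex.exp (-(N * θ * Complex.I)) = 2 * Real.pi * (partsCount p N * Real.exp (-α * N)) := by
  have hs := summable_partsCount h0 hα
  have key := intervalIntegral.hasSum_integral_of_dominated_convergence
    (a := -Real.pi) (b := Real.pi) (μ := MeasureTheory.volume)
    (F := fun (n : ℕ) (θ : ℝ) => (partsCount p n : ℂ) * pt α θ ^ n *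
      Complex.exp (-(N * θ * Complex.I)))
    (f := fun θ => Complex.exp (∑' i, (wt p i : ℂ) * pt α θ ^ sz i) *
      Complex.exp (-(N * θ * Complex.I)))
    (fun n _ => (partsCount p n : ℝ) * Real.exp (-α) ^ n)
    (fun n => by
      refine Continuous.aestronglyMeasurable ?_
      unfold pt
      fun_prop)
    (fun n => Eventually.of_forall fun θ _ => by
      rw [norm_mul, norm_mul, norm_pow, norm_pt, Complex.norm_natCast, Complex.norm_exp]
      simp)
    (Eventually.of_forall fun θ _ => hs)
    (by simp)
    (Eventually.of_forall fun θ _ => by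
      have h1 : Summable fun n => (partsCount p n : ℂ) * pt α θ ^ n :=
        Summable.of_norm (hs.congr fun n => by
          rw [norm_mul, norm_pow, norm_pt, Complex.norm_natCast])
      have h2 := h1.hasSum
      rw [tsum_partsCount h0 hα θ] at h2
      exact h2.mul_right _)
  refine key.unique ?_
  have hterm : ∀ n : ℕ, ∫ θ in (-Real.pi)..Real.pi, (partsCount p n : ℂ) * pt α θ ^ n *
      Complex.exp (-(N * θ * Complex.I)) =
      if n = N then (2 * Real.pi * (partsCount p N * Real.exp (-α * N)) : ℂ) else 0 := by
    intro n
    have h1 : ∀ θ : ℝ, (partsCount p n : ℂ) * pt α θ ^ n * Complex.exp (-(N * θ * Complex.I)) =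
        ((partsCount p n : ℂ) * Real.exp (-α * n)) *
          Complex.exp (((n - N : ℤ) : ℂ) * Complex.I * θ) := by
      intro θ
      rw [pt_pow, ← mul_assoc, mul_assoc, ← Complex.exp_add]
      congr 2
      push_cast; ring
    simp_rw [h1]
    rw [intervalIntegral.integral_const_mul, integral_exp_int]
    by_cases hn : n = N
    · subst hn
      simp
      ring
    · rw [if_neg hn, if_neg (by omega), mul_zero]
  simp_rw [hterm]
  exact hasSum_ite_eq N _

end Fourier

/-! ### Elementary estimates and integrals against the decay -/

section Estimates

theorem norm_exp_I_taylor (x : ℝ) :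
    ‖Complex.exp (x * Complex.I) - 1 - x * Complex.I + x ^ 2 / 2‖ ≤ 4 * |x| ^ 3 := by
  have hn : ‖(x * Complex.I : ℂ)‖ = |x| := by simp
  rcases le_total |x| 1 with h | h
  · have h1 := Complex.norm_exp_sub_sum_le_norm_mul_exp (x * Complex.I) 3
    rw [hn] at h1
    have h2 : Complex.exp (x * Complex.I) -
        ∑ m ∈ range 3, (x * Complex.I : ℂ) ^ m / m.factorial =
        Complex.exp (x * Complex.I) - 1 - x * Complex.I + x ^ 2 / 2 := by
      simp [sum_range_succ, mul_pow, Nat.factorial]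
      ring
    rw [h2] at h1
    refine h1.trans ?_
    have h3 : Real.exp |x| ≤ 4 := by
      have := Real.exp_le_exp.2 h
      have := Real.exp_one_lt_d9
      linarith
    rw [mul_comm]
    gcongr
  · have h1 : ‖Complex.exp (x * Complex.I) - 1 - x * Complex.I + x ^ 2 / 2‖ ≤
        1 + 1 + |x| + |x| ^ 2 / 2 := by
      calc _ ≤ ‖Complex.exp (x * Complex.I)‖ + ‖(1 : ℂ)‖ + ‖(x * Complex.I : ℂ)‖ +
            ‖(x ^ 2 / 2 : ℂ)‖ :=
          (norm_add_le _ _).trans (add_le_add (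
            (norm_sub_le _ _).trans (add_le_add (norm_sub_le _ _) le_rfl)) le_rfl)
        _ = _ := by
          rw [Complex.norm_exp_ofReal_mul_I, hn]; simp
    refine h1.trans ?_
    nlinarith [sq_nonneg (|x| - 1), mul_nonneg (sub_nonneg.2 h) (sq_nonneg |x|)]

/-- The mean value inequality on the convex half-plane Re ≤ M, where |exp'| ≤ e^M. -/
theorem norm_exp_sub_exp_le {z w : ℂ} {M : ℝ} (hz : z.re ≤ M) (hw : w.re ≤ M) :
    ‖Complex.exp z - Complex.exp w‖ ≤ Real.exp M * ‖z - w‖ := by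
  refine (convex_halfSpace_re_le M).norm_image_sub_le_of_norm_deriv_le (f := Complex.exp)
    (fun x _ => Complex.differentiable_exp.differentiableAt) (fun x hx => ?_) hw hz
  rw [Complex.deriv_exp, Complex.norm_exp]
  exact Real.exp_le_exp.2 hx

/-- The rate of decay of the characteristic function. -/
noncomputable def decay (c a θ : ℝ) : ℝ := c * min (1 / a ^ 2) ((θ / a ^ 3) ^ 2)

/-- A uniform integrable majorant at scale a³. Near 0 the Gaussian decay provides it; farther out
e^(-c/a²) beats every power of 1/a, while |θ| ≤ π keeps θ/a³ polynomial in 1/a. -/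
theorem exp_neg_decay_le {c : ℝ} (hc : 0 < c) : ∃ C₁ : ℝ, 0 < C₁ ∧ ∀ a θ : ℝ, 0 < a → a ≤ 1 →
    |θ| ≤ Real.pi → Real.exp (-decay c a θ) ≤ C₁ / (1 + (θ / a ^ 3) ^ 2) ^ 3 := by
  refine ⟨6 * Real.exp c / c ^ 3 + 1331 * (Nat.factorial 9) / c ^ 9, by positivity, ?_⟩
  intro a θ ha ha1 hθ
  rw [le_div_iff₀ (by positivity)]
  rcases le_total ((θ / a ^ 3) ^ 2) (1 / a ^ 2) with h | h
  · rw [decay, min_eq_right h]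
    set x := (θ / a ^ 3) ^ 2 with hx
    have hx0 : 0 ≤ x := by positivity
    have h1 := Real.pow_div_factorial_le_exp (c * (1 + x)) (by positivity) 3
    have h2 : Real.exp (c * (1 + x)) = Real.exp c * Real.exp (c * x) := by
      rw [← Real.exp_add]; congr 1; ring
    rw [h2, div_le_iff₀ (by positivity), mul_pow, show ((Nat.factorial 3 : ℕ) : ℝ) = 6 by
      norm_num [Nat.factorial]] at h1
    have h3 : (1 + x) ^ 3 ≤ 6 * Real.exp c / c ^ 3 * Real.exp (c * x) := by
      rw [div_mul_eq_mul_div, le_div_iff₀ (by positivity)]; linarith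
    calc Real.exp (-(c * x)) * (1 + x) ^ 3 ≤
        Real.exp (-(c * x)) * (6 * Real.exp c / c ^ 3 * Real.exp (c * x)) := by gcongr
      _ = 6 * Real.exp c / c ^ 3 := by rw [Real.exp_neg]; field_simp
      _ ≤ _ := le_add_of_nonneg_right (by positivity)
  · rw [decay, min_eq_left h]
    set y := 1 / a ^ 2 with hy
    have hy1 : 1 ≤ y := by
      rw [hy, le_div_iff₀ (by positivity), one_mul]
      exact pow_le_one₀ ha.le ha1
    have hxy : (θ / a ^ 3) ^ 2 ≤ 10 * y ^ 3 := by
      have h1 : θ ^ 2 ≤ 10 := by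
        have := Real.pi_lt_d2
        have h2 : |θ| ^ 2 ≤ Real.pi ^ 2 := pow_le_pow_left₀ (abs_nonneg _) hθ 2
        rw [sq_abs] at h2
        nlinarith [Real.pi_pos]
      have h2 : (θ / a ^ 3) ^ 2 = θ ^ 2 * y ^ 3 := by
        rw [hy]; field_simp
      rw [h2]; gcongr
    have h11 : 1 + (θ / a ^ 3) ^ 2 ≤ 11 * y ^ 3 := by
      have : 1 ≤ y ^ 3 := one_le_pow₀ hy1
      linarith
    -- The ninth power, since (11 y³)³ = 1331 y⁹ has to be absorbed.
    have h1 := Real.pow_div_factorial_le_exp (c * y) (by positivity) 9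
    rw [div_le_iff₀ (by positivity), mul_pow] at h1
    have h3 : y ^ 9 ≤ (Nat.factorial 9) / c ^ 9 * Real.exp (c * y) := by
      rw [div_mul_eq_mul_div, le_div_iff₀ (by positivity)]; linarith
    calc Real.exp (-(c * y)) * (1 + (θ / a ^ 3) ^ 2) ^ 3 ≤
        Real.exp (-(c * y)) * (11 * y ^ 3) ^ 3 := by gcongr
      _ = Real.exp (-(c * y)) * (1331 * y ^ 9) := by ring
      _ ≤ Real.exp (-(c * y)) * (1331 * ((Nat.factorial 9) / c ^ 9 * Real.exp (c * y))) := by gcongr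
      _ = 1331 * (Nat.factorial 9) / c ^ 9 := by rw [Real.exp_neg]; field_simp
      _ ≤ _ := le_add_of_nonneg_left (by positivity)

theorem integral_cauchy_le {s : ℝ} (hs : 0 < s) :
    ∫ θ in (-Real.pi)..Real.pi, 1 / (1 + (θ / s) ^ 2) ≤ s * Real.pi := by
  rw [intervalIntegral.integral_comp_div (fun x => 1 / (1 + x ^ 2)) hs.ne',
    integral_one_div_one_add_sq, smul_eq_mul]
  gcongr
  have h1 := Real.arctan_lt_pi_div_two (Real.pi / s)
  have h2 := Real.neg_pi_div_two_lt_arctan (-Real.pi / s)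
  linarith

/-- Moments of the function dominating the characteristic function. -/
theorem abs_pow_mul_le {j : ℕ} (hj : j ≤ 4) {s : ℝ} (hs : 0 < s) (θ : ℝ) :
    |θ| ^ j / (1 + (θ / s) ^ 2) ^ 3 ≤ s ^ j * (1 / (1 + (θ / s) ^ 2)) := by
  have h1 : |θ / s| ^ j ≤ (1 + (θ / s) ^ 2) ^ 2 := by
    have h2 : |θ / s| ^ 2 = (θ / s) ^ 2 := sq_abs _
    rw [← h2]
    set y := |θ / s| with hy
    have hy0 : 0 ≤ y := abs_nonneg _
    have hyy : y ≤ 1 + y ^ 2 := by nlinarith [sq_nonneg (y - 1)]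
    interval_cases j
    · rw [pow_zero]; nlinarith [sq_nonneg y]
    · nlinarith [sq_nonneg (y ^ 2)]
    · nlinarith [sq_nonneg (y ^ 2)]
    · calc y ^ 3 = y * y ^ 2 := by ring
        _ ≤ (1 + y ^ 2) * (1 + y ^ 2) := by gcongr; linarith
        _ = _ := by ring
    · nlinarith [sq_nonneg y]
  have h3 : |θ| ^ j = s ^ j * |θ / s| ^ j := by
    rw [← mul_pow, abs_div, abs_of_pos hs]; congr 1; field_simp
  rw [h3, mul_div_assoc]
  refine mul_le_mul_of_nonneg_left ?_ (by positivity)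
  rw [div_le_div_iff₀ (by positivity) (by positivity)]
  calc |θ / s| ^ j * (1 + (θ / s) ^ 2) ≤ (1 + (θ / s) ^ 2) ^ 2 * (1 + (θ / s) ^ 2) := by gcongr
    _ = _ := by ring

/-- Each factor |θ| costs a³, and the integration costs one more a³. -/
theorem norm_integral_le_of_decay {f : ℝ → ℂ} {B C₁ c a : ℝ} {j : ℕ} (hj : j ≤ 4) (hB : 0 ≤ B)
    (hC₁ : 0 < C₁) (ha : 0 < a) (ha1 : a ≤ 1)
    (hdom : ∀ a θ : ℝ, 0 < a → a ≤ 1 →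
      |θ| ≤ Real.pi → Real.exp (-decay c a θ) ≤ C₁ / (1 + (θ / a ^ 3) ^ 2) ^ 3)
    (hf : ∀ θ, |θ| ≤ Real.pi → ‖f θ‖ ≤ B * |θ| ^ j * Real.exp (-decay c a θ)) :
    ‖∫ θ in (-Real.pi)..Real.pi, f θ‖ ≤ B * C₁ * (a ^ 3) ^ (j + 1) * Real.pi := by
  have hpi : -Real.pi ≤ Real.pi := by linarith [Real.pi_pos]
  have hs : 0 < a ^ 3 := by positivity
  have h1 : ∀ θ ∈ Set.Ioc (-Real.pi) Real.pi,
      ‖f θ‖ ≤ B * C₁ * (a ^ 3) ^ j * (1 / (1 + (θ / a ^ 3) ^ 2)) := by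
    intro θ hθ
    have hθ' : |θ| ≤ Real.pi := abs_le.2 ⟨hθ.1.le, hθ.2⟩
    calc ‖f θ‖ ≤ B * |θ| ^ j * Real.exp (-decay c a θ) := hf θ hθ'
      _ ≤ B * |θ| ^ j * (C₁ / (1 + (θ / a ^ 3) ^ 2) ^ 3) := by
        gcongr; exact hdom a θ ha ha1 hθ'
      _ = B * C₁ * (|θ| ^ j / (1 + (θ / a ^ 3) ^ 2) ^ 3) := by ring
      _ ≤ B * C₁ * ((a ^ 3) ^ j * (1 / (1 + (θ / a ^ 3) ^ 2))) := by
        gcongr ?_ * ?_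
        exact abs_pow_mul_le hj hs θ
      _ = _ := by ring
  have hcont : Continuous fun θ : ℝ => B * C₁ * (a ^ 3) ^ j * (1 / (1 + (θ / a ^ 3) ^ 2)) := by
    refine continuous_const.mul (continuous_const.div (by fun_prop) fun θ => ?_)
    positivity
  calc ‖∫ θ in (-Real.pi)..Real.pi, f θ‖ ≤
      ∫ θ in (-Real.pi)..Real.pi, B * C₁ * (a ^ 3) ^ j * (1 / (1 + (θ / a ^ 3) ^ 2)) :=
        intervalIntegral.norm_integral_le_of_norm_le hpi
          (Eventually.of_forall h1) (hcont.intervalIntegrable _ _)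
    _ = B * C₁ * (a ^ 3) ^ j * ∫ θ in (-Real.pi)..Real.pi, 1 / (1 + (θ / a ^ 3) ^ 2) :=
        intervalIntegral.integral_const_mul _ _
    _ ≤ B * C₁ * (a ^ 3) ^ j * (a ^ 3 * Real.pi) := by gcongr; exact integral_cauchy_le hs
    _ = _ := by ring

end Estimates

end PartitionAsymptotics

namespace PartitionAsymptotics

open Filter Topology Finset

/-! ### Local limit theorem for compound Poisson laws -/

section LocalLimit

variable {ι : Type*} {b : ι → ℝ} {ν : ι → ℕ}

theorem continuous_charExponent (hb : ∀ i, 0 ≤ b i) (h0 : Summable b) :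
    Continuous fun θ : ℝ => ∑' i, (b i : ℂ) * (Complex.exp ((θ * ν i : ℝ) * Complex.I) - 1) := by
  refine continuous_tsum (u := fun i => 2 * b i) (fun i => by fun_prop) (h0.mul_left 2) ?_
  intro i θ
  rw [norm_mul, Complex.norm_real, Real.norm_of_nonneg (hb i), mul_comm]
  gcongr
  · exact hb i
  · calc _ ≤ ‖Complex.exp ((θ * ν i : ℝ) * Complex.I)‖ + ‖(1 : ℂ)‖ := norm_sub_le _ _
      _ = 2 := by rw [Complex.norm_exp_ofReal_mul_I, norm_one]; norm_num

theorem summable_charExponent (hb : ∀ i, 0 ≤ b i) (h0 : Summable b) (θ : ℝ) :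
    Summable fun i => (b i : ℂ) * (Complex.exp ((θ * ν i : ℝ) * Complex.I) - 1) := by
  refine Summable.of_norm_bounded (h0.mul_left 2) fun i => ?_
  rw [norm_mul, Complex.norm_real, Real.norm_of_nonneg (hb i), mul_comm]
  gcongr
  · exact hb i
  · calc _ ≤ ‖Complex.exp ((θ * ν i : ℝ) * Complex.I)‖ + ‖(1 : ℂ)‖ := norm_sub_le _ _
      _ = 2 := by rw [Complex.norm_exp_ofReal_mul_I, norm_one]; norm_num

theorem re_charExponent (hb : ∀ i, 0 ≤ b i) (h0 : Summable b) (θ : ℝ) :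
    (∑' i, (b i : ℂ) * (Complex.exp ((θ * ν i : ℝ) * Complex.I) - 1)).re =
      -∑' i, b i * (1 - Real.cos (θ * ν i)) := by
  rw [Complex.re_tsum (summable_charExponent hb h0 θ), ← tsum_neg]
  refine tsum_congr fun i => ?_
  rw [Complex.re_ofReal_mul, Complex.sub_re, Complex.exp_ofReal_mul_I_re, Complex.one_re]
  ring

/-- Termwise Taylor expansion to second order, so that the error is controlled by the third moment.
-/
theorem norm_charExponent_sub_le (hb : ∀ i, 0 ≤ b i) (h0 : Summable b)
    (h1 : Summable fun i => b i * ν i) (h2 : Summable fun i => b i * (ν i : ℝ) ^ 2)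
    (h3 : Summable fun i => b i * (ν i : ℝ) ^ 3) (θ : ℝ) :
    ‖∑' i, (b i : ℂ) * (Complex.exp ((θ * ν i : ℝ) * Complex.I) - 1) -
      ((∑' i, b i * ν i : ℝ) * θ * Complex.I) -
      ((-(∑' i, b i * (ν i : ℝ) ^ 2) * θ ^ 2 / 2 : ℝ) : ℂ)‖ ≤
      4 * (∑' i, b i * (ν i : ℝ) ^ 3) * |θ| ^ 3 := by
  have e1 := (Complex.hasSum_ofReal.2 h1.hasSum).mul_right (θ * Complex.I)
  have e2 := Complex.hasSum_ofReal.2 (h2.hasSum.mul_right (-θ ^ 2 / 2))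
  have e := ((summable_charExponent (ν := ν) hb h0 θ).hasSum.sub e1).sub e2
  have e3 := h3.hasSum.mul_right (4 * |θ| ^ 3)
  have hle : ∀ i, ‖(b i : ℂ) * (Complex.exp ((θ * ν i : ℝ) * Complex.I) - 1) -
      ((b i * ν i : ℝ) : ℂ) * (θ * Complex.I) - ((b i * (ν i : ℝ) ^ 2 * (-θ ^ 2 / 2) : ℝ) : ℂ)‖ ≤
      b i * (ν i : ℝ) ^ 3 * (4 * |θ| ^ 3) := by
    intro i
    have ht := norm_exp_I_taylor (θ * ν i)
    have heq : (b i : ℂ) * (Complex.exp ((θ * ν i : ℝ) * Complex.I) - 1) -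
      ((b i * ν i : ℝ) : ℂ) * (θ * Complex.I) - ((b i * (ν i : ℝ) ^ 2 * (-θ ^ 2 / 2) : ℝ) : ℂ) =
      (b i : ℂ) * (Complex.exp ((θ * ν i : ℝ) * Complex.I) - 1 - (θ * ν i : ℝ) * Complex.I +
        (θ * ν i : ℝ) ^ 2 / 2) := by
      push_cast; ring
    rw [heq, norm_mul, Complex.norm_real, Real.norm_of_nonneg (hb i)]
    calc b i * _ ≤ b i * (4 * |θ * ν i| ^ 3) := mul_le_mul_of_nonneg_left ht (hb i)
      _ = _ := by rw [abs_mul, Nat.abs_cast]; ring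
  have hfin := tsum_of_norm_bounded e3 hle
  rw [e.tsum_eq] at hfin
  have c1 : ∀ A : ℂ, A - ((∑' i, b i * ν i : ℝ) * θ * Complex.I) -
      ((-(∑' i, b i * (ν i : ℝ) ^ 2) * θ ^ 2 / 2 : ℝ) : ℂ) =
      A - ((∑' i, b i * ν i : ℝ) : ℂ) * (θ * Complex.I) -
        (((∑' i, b i * (ν i : ℝ) ^ 2) * (-θ ^ 2 / 2) : ℝ) : ℂ) := by
    intro A; push_cast; ring
  rw [c1]
  refine hfin.trans (le_of_eq ?_)
  ring

theorem tsum_one_sub_cos_le (hb : ∀ i, 0 ≤ b i) (h0 : Summable b)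
    (h2 : Summable fun i => b i * (ν i : ℝ) ^ 2) (θ : ℝ) :
    ∑' i, b i * (1 - Real.cos (θ * ν i)) ≤ (∑' i, b i * (ν i : ℝ) ^ 2) * θ ^ 2 / 2 := by
  have hs : Summable fun i => b i * (1 - Real.cos (θ * ν i)) := by
    refine Summable.of_nonneg_of_le (fun i => ?_) (fun i => ?_) (h0.mul_right 2)
    · exact mul_nonneg (hb i) (by linarith [Real.cos_le_one (θ * ν i)])
    · exact mul_le_mul_of_nonneg_left (by linarith [Real.neg_one_le_cos (θ * ν i)]) (hb i)
  rw [mul_div_assoc, ← tsum_mul_right]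
  refine hs.tsum_le_tsum (fun i => ?_) (h2.mul_right _)
  rw [mul_assoc]
  refine mul_le_mul_of_nonneg_left ?_ (hb i)
  have := Real.one_sub_sq_div_two_le_cos (x := θ * ν i)
  linarith

/-- On |θ| ≤ s the exponent is at least -C/2; the rest of the integral is nonnegative. -/
theorem gaussian_integral_ge {s V C : ℝ} (hs : 0 < s) (hs1 : s ≤ 1) (hV : 0 ≤ V)
    (hVC : V ≤ C / s ^ 2) :
    2 * Real.exp (-C / 2) * s ≤ ∫ θ in (-Real.pi)..Real.pi, Real.exp (-V * θ ^ 2 / 2) := by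
  have hpi : s ≤ Real.pi := by linarith [Real.pi_gt_three]
  have hcont : Continuous fun θ : ℝ => Real.exp (-V * θ ^ 2 / 2) := by fun_prop
  calc 2 * Real.exp (-C / 2) * s = ∫ _ in (-s)..s, Real.exp (-C / 2) := by
        rw [intervalIntegral.integral_const, smul_eq_mul]; ring
    _ ≤ ∫ θ in (-s)..s, Real.exp (-V * θ ^ 2 / 2) := by
        refine intervalIntegral.integral_mono_on (by linarith) (by simp)
          (hcont.intervalIntegrable _ _) fun θ hθ => ?_
        have h1 : θ ^ 2 ≤ s ^ 2 := sq_le_sq' hθ.1 hθ.2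
        have h2 : V * θ ^ 2 ≤ C := by
          calc V * θ ^ 2 ≤ C / s ^ 2 * s ^ 2 := by
                refine mul_le_mul hVC h1 (by positivity) (hV.trans hVC)
            _ = C := by field_simp
        apply Real.exp_le_exp.2
        linarith
    _ ≤ _ := by
        refine intervalIntegral.integral_mono_interval (by linarith) (by linarith) hpi
          (Eventually.of_forall fun θ => (Real.exp_pos _).le) (hcont.intervalIntegrable _ _)

/-- A quantitative local limit theorem for compound Poisson laws: near its mean, such a law is
flat. -/
theorem local_limit {c C : ℝ} (hc : 0 < c) (hC : 0 < C) :
    ∃ a₀ D : ℝ, 0 < a₀ ∧ 0 < D ∧ ∀ {ι : Type} (b : ι → ℝ) (ν : ι → ℕ) (w : ℕ → ℝ) (N : ℕ) (a : ℝ),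
      0 < a → a ≤ a₀ → (∀ i, 0 ≤ b i) → Summable b → (Summable fun i => b i * ν i) →
      (Summable fun i => b i * (ν i : ℝ) ^ 2) → (Summable fun i => b i * (ν i : ℝ) ^ 3) →
      (∀ n : ℕ, ∫ θ in (-Real.pi)..Real.pi,
        Complex.exp (∑' i, (b i : ℂ) * (Complex.exp ((θ * ν i : ℝ) * Complex.I) - 1)) *
          Complex.exp (-(n * θ * Complex.I)) = ((2 * Real.pi * w n : ℝ) : ℂ)) →
      ∑' i, b i * ν i = N →
      (∀ θ : ℝ, |θ| ≤ Real.pi → decay c a θ ≤ ∑' i, b i * (1 - Real.cos (θ * ν i))) →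
      ∑' i, b i * (ν i : ℝ) ^ 2 ≤ C / a ^ 6 → ∑' i, b i * (ν i : ℝ) ^ 3 ≤ C / a ^ 8 →
      0 < w N ∧ ∀ n : ℕ, |w n / w N - 1| ≤ D * |(n : ℝ) - N| * a ^ 3 := by
  obtain ⟨C₁, hC₁, hdom⟩ := exp_neg_decay_le hc
  set E := Real.exp (-C / 2) with hE
  have hE0 : 0 < E := Real.exp_pos _
  have hpi := Real.pi_pos
  -- This a₀ makes the Gaussian approximation error at most half of the lower bound 2E a³ for the
  -- Gaussian integral.
  refine ⟨min 1 (E / (4 * C * C₁ * Real.pi)), C₁ * Real.pi / E, lt_min one_pos (by positivity),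
    by positivity, ?_⟩
  intro ι b ν w N a ha ha0 hb h0 h1 h2 h3 hw hmean hlow hvar hthird
  have ha1 : a ≤ 1 := ha0.trans (min_le_left _ _)
  have ha2 : a ≤ E / (4 * C * C₁ * Real.pi) := ha0.trans (min_le_right _ _)
  set A : ℝ → ℂ := fun θ => ∑' i, (b i : ℂ) * (Complex.exp ((θ * ν i : ℝ) * Complex.I) - 1) with hA
  have hAc : Continuous A := continuous_charExponent hb h0
  set V := ∑' i, b i * (ν i : ℝ) ^ 2 with hV
  have hV0 : 0 ≤ V := tsum_nonneg fun i => mul_nonneg (hb i) (by positivity)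
  set ψ : ℝ → ℂ := fun θ => A θ - N * θ * Complex.I with hψ
  have hψc : Continuous ψ := by fun_prop
  have hre : ∀ θ, (ψ θ).re = -∑' i, b i * (1 - Real.cos (θ * ν i)) := by
    intro θ
    have : ((N : ℂ) * θ * Complex.I).re = 0 := by simp
    rw [hψ, Complex.sub_re, this, sub_zero, re_charExponent hb h0]
  have hre1 : ∀ θ, |θ| ≤ Real.pi → (ψ θ).re ≤ -decay c a θ := fun θ hθ => by
    rw [hre]; exact neg_le_neg (hlow θ hθ)
  -- The Gaussian obeys the same decay, since ∑ b(1 - cos) ≤ Vθ²/2. Both exponents thus lie in one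
  -- half-plane, as `norm_exp_sub_exp_le` requires.
  have hre2 : ∀ θ, |θ| ≤ Real.pi → -V * θ ^ 2 / 2 ≤ -decay c a θ := fun θ hθ => by
    have e1 := hlow θ hθ
    have e2 := tsum_one_sub_cos_le (ν := ν) hb h0 h2 θ
    linarith
  have hint : ∀ n : ℕ, ∫ θ in (-Real.pi)..Real.pi, Complex.exp (ψ θ) *
      Complex.exp (((N : ℝ) - n : ℝ) * θ * Complex.I) = ((2 * Real.pi * w n : ℝ) : ℂ) := by
    intro n
    rw [← hw n]
    refine intervalIntegral.integral_congr fun θ _ => ?_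
    simp only [hψ, hA]
    rw [← Complex.exp_add, ← Complex.exp_add]
    congr 1
    push_cast; ring
  have hintN : ∫ θ in (-Real.pi)..Real.pi, Complex.exp (ψ θ) = ((2 * Real.pi * w N : ℝ) : ℂ) := by
    rw [← hint N]
    simp
  have hgauss : ‖((2 * Real.pi * w N : ℝ) : ℂ) -
      ((∫ θ in (-Real.pi)..Real.pi, Real.exp (-V * θ ^ 2 / 2) : ℝ) : ℂ)‖ ≤
      (4 * (C / a ^ 8)) * C₁ * (a ^ 3) ^ (3 + 1) * Real.pi := by
    rw [← hintN, ← intervalIntegral.integral_ofReal, ← intervalIntegral.integral_sub]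
    · refine norm_integral_le_of_decay (c := c) (by norm_num) (by positivity) hC₁ ha ha1 hdom
        fun θ hθ => ?_
      rw [Complex.ofReal_exp]
      refine (norm_exp_sub_exp_le (hre1 θ hθ) (by rw [Complex.ofReal_re]; exact hre2 θ hθ)).trans ?_
      rw [mul_comm]
      refine mul_le_mul_of_nonneg_right ?_ (Real.exp_pos _).le
      have e1 := norm_charExponent_sub_le hb h0 h1 h2 h3 θ
      rw [hmean] at e1
      refine (le_trans (le_of_eq ?_) e1).trans ?_
      · simp only [hψ, hA, hV]; push_cast; rfl
      · gcongr
    · exact (Complex.continuous_exp.comp hψc).intervalIntegrable _ _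
    · exact (by fun_prop : Continuous fun θ : ℝ => ((Real.exp (-V * θ ^ 2 / 2) : ℝ) : ℂ)
        ).intervalIntegrable _ _
  rw [← Complex.ofReal_sub, Complex.norm_real, Real.norm_eq_abs, abs_le] at hgauss
  have hge := gaussian_integral_ge (s := a ^ 3) (C := C) (by positivity) (pow_le_one₀ ha.le ha1)
    hV0 (by rw [← pow_mul]; exact hvar)
  -- The third moment contributes a^-8 (a³)⁴ = a · a³, a factor a below the main term.
  have herr : (4 * (C / a ^ 8)) * C₁ * (a ^ 3) ^ (3 + 1) * Real.pi ≤ E * a ^ 3 := by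
    have : (4 * (C / a ^ 8)) * C₁ * (a ^ 3) ^ (3 + 1) * Real.pi =
        a * (4 * C * C₁ * Real.pi) * a ^ 3 := by field_simp; ring
    rw [this]
    rw [le_div_iff₀ (by positivity)] at ha2
    gcongr
  have hwN : E * a ^ 3 ≤ 2 * Real.pi * w N := by
    have := hgauss.1
    linarith
  have hEa : 0 < E * a ^ 3 := by positivity
  have hwN0 : 0 < w N := by
    by_contra h
    rw [not_lt] at h
    nlinarith
  refine ⟨hwN0, fun n => ?_⟩
  -- Moving from N to n multiplies the integrand by e^(i(N-n)θ), whose distance to 1 is at most |n -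
  -- N||θ|. The integral is then of order |n - N| a⁶, against w(N) of order at least a³.
  have hdiff : ‖((2 * Real.pi * w n : ℝ) : ℂ) - ((2 * Real.pi * w N : ℝ) : ℂ)‖ ≤
      |(n : ℝ) - N| * C₁ * (a ^ 3) ^ (1 + 1) * Real.pi := by
    rw [← hint n, ← hintN, ← intervalIntegral.integral_sub]
    · refine norm_integral_le_of_decay (c := c) (by norm_num) (abs_nonneg _) hC₁ ha ha1 hdom
        fun θ hθ => ?_
      have e1 : Complex.exp (ψ θ) * Complex.exp (((N : ℝ) - n : ℝ) * θ * Complex.I) -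
          Complex.exp (ψ θ) = Complex.exp (ψ θ) *
            (Complex.exp (Complex.I * ((((N : ℝ) - n) * θ : ℝ) : ℂ)) - 1) := by
        rw [mul_sub, mul_one]; congr 3; push_cast; ring
      rw [e1, norm_mul, Complex.norm_exp, mul_comm, pow_one]
      refine mul_le_mul ?_ (Real.exp_le_exp.2 (hre1 θ hθ)) (Real.exp_pos _).le (by positivity)
      refine (Real.norm_exp_I_mul_ofReal_sub_one_le).trans ?_
      rw [Real.norm_eq_abs, abs_mul, abs_sub_comm]
    · exact Continuous.intervalIntegrable (by fun_prop) _ _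
    · exact (Complex.continuous_exp.comp hψc).intervalIntegrable _ _
  rw [← Complex.ofReal_sub, Complex.norm_real, Real.norm_eq_abs, ← mul_sub, abs_mul,
    abs_of_pos (by positivity : (0 : ℝ) < 2 * Real.pi)] at hdiff
  rw [div_sub_one hwN0.ne', abs_div, abs_of_pos hwN0, div_le_iff₀ hwN0]
  have hx : 0 ≤ |(n : ℝ) - N| := abs_nonneg _
  have hfin : |(n : ℝ) - N| * C₁ * (a ^ 3) ^ (1 + 1) * Real.pi ≤
      2 * Real.pi * (C₁ * Real.pi / E * |(n : ℝ) - N| * a ^ 3 * w N) := by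
    calc |(n : ℝ) - N| * C₁ * (a ^ 3) ^ (1 + 1) * Real.pi =
        C₁ * Real.pi / E * |(n : ℝ) - N| * a ^ 3 * (E * a ^ 3) := by field_simp; ring
      _ ≤ C₁ * Real.pi / E * |(n : ℝ) - N| * a ^ 3 * (2 * Real.pi * w N) := by gcongr
      _ = _ := by ring
  exact le_of_mul_le_mul_left (hdiff.trans hfin) (by positivity)

end LocalLimit

end PartitionAsymptotics

namespace PartitionAsymptotics

open Filter Topology Finset

/-! ### Decay of the characteristic function away from 0 -/

section MinorArcs

theorem one_sub_cos_eq (x : ℝ) : 1 - Real.cos x = 2 * Real.sin (x / 2) ^ 2 := by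
  have := Real.cos_two_mul (x / 2)
  rw [show 2 * (x / 2) = x by ring] at this
  have := Real.sin_sq_add_cos_sq (x / 2)
  linarith

theorem abs_sin_add_le (x y : ℝ) : |Real.sin (x + y)| ≤ |Real.sin x| + |Real.sin y| := by
  rw [Real.sin_add]
  calc _ ≤ |Real.sin x * Real.cos y| + |Real.cos x * Real.sin y| := abs_add_le _ _
    _ ≤ _ := by
      rw [abs_mul, abs_mul]
      nlinarith [abs_nonneg (Real.sin x), abs_nonneg (Real.sin y), Real.abs_cos_le_one x,
        Real.abs_cos_le_one y]

/-- As 1 - cos x = |e^(ix) - 1|²/2, this is the triangle inequality combined with (s + t)² ≤ 2s² +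
2t². -/
theorem one_sub_cos_add_le (x y : ℝ) :
    1 - Real.cos (x + y) ≤ 2 * (1 - Real.cos x) + 2 * (1 - Real.cos y) := by
  rw [one_sub_cos_eq, one_sub_cos_eq, one_sub_cos_eq, add_div]
  have h := abs_sin_add_le (x / 2) (y / 2)
  have h2 := pow_le_pow_left₀ (abs_nonneg _) h 2
  rw [sq_abs] at h2
  nlinarith [sq_nonneg (|Real.sin (x / 2)| - |Real.sin (y / 2)|), sq_abs (Real.sin (x / 2)),
    sq_abs (Real.sin (y / 2))]

theorem one_sub_cos_sub_le (x y : ℝ) :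
    1 - Real.cos (x - y) ≤ 2 * (1 - Real.cos x) + 2 * (1 - Real.cos y) := by
  have := one_sub_cos_add_le x (-y)
  rwa [Real.cos_neg, ← sub_eq_add_neg] at this

theorem abs_sin_nat_mul_le (n : ℕ) (x : ℝ) : |Real.sin (n * x)| ≤ n * |Real.sin x| := by
  induction n with
  | zero => simp
  | succ n ih =>
    push_cast
    rw [add_mul, add_mul, one_mul, one_mul]
    exact (abs_sin_add_le _ _).trans (by linarith)

theorem one_sub_cos_int_mul_le (n : ℤ) (x : ℝ) :
    1 - Real.cos (n * x) ≤ (n : ℝ) ^ 2 * (1 - Real.cos x) := by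
  have key : ∀ m : ℕ, 1 - Real.cos (m * x) ≤ (m : ℝ) ^ 2 * (1 - Real.cos x) := by
    intro m
    rw [one_sub_cos_eq, one_sub_cos_eq, mul_div_assoc]
    have h := pow_le_pow_left₀ (abs_nonneg _) (abs_sin_nat_mul_le m (x / 2)) 2
    rw [sq_abs, mul_pow, sq_abs] at h
    linarith
  obtain ⟨m, rfl | rfl⟩ := n.eq_nat_or_neg
  · exact_mod_cast key m
  · have := key m
    push_cast
    rw [neg_mul, Real.cos_neg, neg_sq]
    exact this

theorem one_sub_cos_nonneg (x : ℝ) : 0 ≤ 1 - Real.cos x := by linarith [Real.cos_le_one x]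

theorem one_sub_cos_ge {x : ℝ} (hx : |x| ≤ Real.pi) : 2 / Real.pi ^ 2 * x ^ 2 ≤ 1 - Real.cos x := by
  linarith [Real.cos_le_one_sub_mul_cos_sq hx]

/-- A lower bound for the sum of `1 - cos` along an arithmetic progression whose first term is
coprime to its step. -/
theorem exists_sum_one_sub_cos_ge {g δ : ℕ} (hδ : 0 < δ) (hg : Nat.Coprime g δ) :
    ∃ c : ℝ, 0 < c ∧ ∀ (N : ℕ) (θ : ℝ), 0 < N → |θ| ≤ Real.pi →
      c * (N * min 1 ((N * θ) ^ 2)) ≤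
        ∑ j ∈ range (2 * N), (1 - Real.cos (((g + δ * j : ℕ) : ℝ) * θ)) := by
  have hpi := Real.pi_pos
  have hδ' : (0 : ℝ) < δ := by exact_mod_cast hδ
  have hδ1 : (1 : ℝ) ≤ δ := by exact_mod_cast hδ
  set u : ℤ := Nat.gcdA g δ with hu
  set v : ℤ := Nat.gcdB g δ with hv
  have huv : (g : ℤ) * u + δ * v = 1 := by
    rw [hu, hv, ← Nat.gcd_eq_gcd_ab]; exact_mod_cast hg
  set K : ℝ := 20 * (u : ℝ) ^ 2 + 8 * (v : ℝ) ^ 2 + 1 with hK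
  have hK0 : 0 < K := by positivity
  refine ⟨min (2 / (δ ^ 2 * K)) (min (1 / (2 * Real.pi ^ 2)) (1 / 8)),
    lt_min (by positivity) (lt_min (by positivity) (by norm_num)), ?_⟩
  intro N θ hN hθ
  have hN' : (0 : ℝ) < N := by exact_mod_cast hN
  set F : ℕ → ℝ := fun j => 1 - Real.cos (((g + δ * j : ℕ) : ℝ) * θ) with hF
  have hF0 : ∀ j, 0 ≤ F j := fun j => one_sub_cos_nonneg _
  set S := ∑ j ∈ range (2 * N), F j with hS
  have hS0 : 0 ≤ S := sum_nonneg fun j _ => hF0 j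
  have hfirst : ∑ j ∈ range N, F j ≤ S :=
    sum_le_sum_of_subset_of_nonneg (range_subset_range.2 (by omega)) fun j _ _ => hF0 j
  have step1 : ∀ h : ℕ, h ≤ N → N * (1 - Real.cos (h * (δ * θ))) ≤ 4 * S := by
    intro h hh
    have h1 : ∀ j ∈ range N, 1 - Real.cos (h * (δ * θ)) ≤ 2 * F (h + j) + 2 * F j := by
      intro j _
      have := one_sub_cos_sub_le (((g + δ * (h + j) : ℕ) : ℝ) * θ) (((g + δ * j : ℕ) : ℝ) * θ)
      refine le_trans (le_of_eq ?_) this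
      congr 2; push_cast; ring
    have h2 := sum_le_sum h1
    rw [sum_const, card_range, nsmul_eq_mul, sum_add_distrib, ← mul_sum, ← mul_sum] at h2
    have h3 : ∑ j ∈ range N, F (h + j) ≤ S := by
      have : ∑ j ∈ range N, F (h + j) = ∑ j ∈ Ico h (h + N), F j := by
        rw [sum_Ico_eq_sum_range, Nat.add_sub_cancel_left]
      rw [this]
      refine sum_le_sum_of_subset_of_nonneg (fun j hj => ?_) fun j _ _ => hF0 j
      rw [mem_Ico] at hj
      rw [mem_range]; omega
    linarith
  have step2 : N * (1 - Real.cos (g * θ)) ≤ 10 * S := by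
    have h1 : ∀ j ∈ range N, 1 - Real.cos (g * θ) ≤
        2 * F j + 2 * (1 - Real.cos (j * (δ * θ))) := by
      intro j _
      have := one_sub_cos_sub_le (((g + δ * j : ℕ) : ℝ) * θ) (j * (δ * θ))
      refine le_trans (le_of_eq ?_) this
      congr 2; push_cast; ring
    have h2 := sum_le_sum h1
    rw [sum_const, card_range, nsmul_eq_mul, sum_add_distrib, ← mul_sum, ← mul_sum] at h2
    have h3 : ∑ j ∈ range N, (1 - Real.cos (j * (δ * θ))) ≤ ∑ j ∈ range N, 4 * S / N := by
      refine sum_le_sum fun j hj => ?_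
      rw [le_div_iff₀ hN', mul_comm]
      exact step1 j (mem_range.1 hj).le
    rw [sum_const, card_range, nsmul_eq_mul, mul_div_cancel₀ _ hN'.ne'] at h3
    linarith
  -- Bézout: θ is an integer combination of gθ and δθ. Coprimality enters here, excluding the other
  -- θ with δθ near 2πℤ.
  have step3 : N * (1 - Real.cos θ) ≤ K * S := by
    have h1 : θ = u * (g * θ) + v * (δ * θ) := by
      have : (g : ℝ) * u + δ * v = 1 := by exact_mod_cast huv
      linear_combination (-θ) * this
    have h2 := one_sub_cos_add_le (u * (g * θ)) (v * (δ * θ))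
    rw [← h1] at h2
    have h3 := one_sub_cos_int_mul_le u (g * θ)
    have h4 := one_sub_cos_int_mul_le v (δ * θ)
    have h5 := step1 1 hN
    rw [Nat.cast_one, one_mul] at h5
    calc N * (1 - Real.cos θ) ≤ N * (2 * ((u : ℝ) ^ 2 * (1 - Real.cos (g * θ))) +
          2 * ((v : ℝ) ^ 2 * (1 - Real.cos (δ * θ)))) := by
          refine mul_le_mul_of_nonneg_left ?_ hN'.le
          linarith
      _ = 2 * (u : ℝ) ^ 2 * (N * (1 - Real.cos (g * θ))) +
          2 * (v : ℝ) ^ 2 * (N * (1 - Real.cos (δ * θ))) := by ring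
      _ ≤ 2 * (u : ℝ) ^ 2 * (10 * S) + 2 * (v : ℝ) ^ 2 * (4 * S) := by gcongr
      _ ≤ K * S := by rw [hK]; linarith
  rcases le_or_gt (Real.pi / δ) |θ| with hbig | hsmall
  · have h1 : 2 / (δ : ℝ) ^ 2 ≤ 1 - Real.cos θ := by
      refine le_trans ?_ (one_sub_cos_ge hθ)
      have h2 := pow_le_pow_left₀ (by positivity) hbig 2
      rw [sq_abs] at h2
      calc 2 / (δ : ℝ) ^ 2 = 2 / Real.pi ^ 2 * (Real.pi / δ) ^ 2 := by field_simp
        _ ≤ _ := by gcongr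
    calc _ ≤ 2 / (δ ^ 2 * K) * (N * 1) := by
          gcongr
          · exact min_le_left _ _
          · exact min_le_left _ _
      _ = (N * (2 / (δ : ℝ) ^ 2)) / K := by field_simp
      _ ≤ (K * S) / K := by
          exact div_le_div_of_nonneg_right
            ((mul_le_mul_of_nonneg_left h1 hN'.le).trans step3) hK0.le
      _ = S := by field_simp
  · rw [lt_div_iff₀ hδ'] at hsmall
    have habs : ∀ h : ℕ, |(h : ℝ) * (δ * θ)| = h * (|θ| * δ) := by
      intro h
      rw [abs_mul, abs_mul, Nat.abs_cast, Nat.abs_cast]; ring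
    rcases le_or_gt ((N : ℝ) * (|θ| * δ)) Real.pi with hle | hgt
    · have h1 := one_sub_cos_ge (x := N * (δ * θ)) (by rw [habs]; exact hle)
      have h2 := step1 N le_rfl
      calc _ ≤ 1 / (2 * Real.pi ^ 2) * (N * (N * θ) ^ 2) := by
            gcongr
            · exact (min_le_right _ _).trans (min_le_left _ _)
            · exact min_le_right _ _
        _ ≤ 1 / (2 * Real.pi ^ 2) * (N * (δ * (N * θ)) ^ 2) := by
            have : (N * θ) ^ 2 ≤ (δ * (N * θ)) ^ 2 := by
              rw [mul_pow (δ : ℝ)]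
              exact le_mul_of_one_le_left (sq_nonneg _) (one_le_pow₀ hδ1)
            gcongr
        _ = N * (2 / Real.pi ^ 2 * (N * (δ * θ)) ^ 2) / 4 := by field_simp; ring
        _ ≤ N * (1 - Real.cos (N * (δ * θ))) / 4 := by gcongr
        _ ≤ S := by linarith
    · have ht0 : 0 < |θ| * δ := by
        by_contra hcon
        rw [not_lt] at hcon
        nlinarith
      -- The shift h = ⌊x⌋ puts h δ|θ| in [π/2, π], where 1 - cos ≥ 1/2.
      set x := Real.pi / (|θ| * δ) with hx
      have hx1 : 1 < x := by rw [hx, lt_div_iff₀ ht0, one_mul]; exact hsmall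
      have hxN : x < N := by rw [hx, div_lt_iff₀ ht0]; exact hgt
      have hf1 : (⌊x⌋₊ : ℝ) ≤ x := Nat.floor_le (by linarith)
      have hf2 : x < ⌊x⌋₊ + 1 := Nat.lt_floor_add_one x
      have hf3 : (1 : ℝ) ≤ ⌊x⌋₊ := by exact_mod_cast Nat.le_floor (by exact_mod_cast hx1.le)
      have hfN : ⌊x⌋₊ ≤ N := by exact_mod_cast hf1.trans hxN.le
      have hxt : x * (|θ| * δ) = Real.pi := by rw [hx, div_mul_cancel₀ _ ht0.ne']
      have h3 : (⌊x⌋₊ : ℝ) * (|θ| * δ) ≤ Real.pi := by rw [← hxt]; gcongr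
      have h4 : Real.pi / 2 ≤ (⌊x⌋₊ : ℝ) * (|θ| * δ) := by
        rw [← hxt, mul_div_right_comm]
        gcongr
        linarith
      have h1 := one_sub_cos_ge (x := ⌊x⌋₊ * (δ * θ)) (by rw [habs]; exact h3)
      have h5 : (Real.pi / 2) ^ 2 ≤ (⌊x⌋₊ * (δ * θ)) ^ 2 := by
        rw [← sq_abs ((⌊x⌋₊ : ℝ) * (δ * θ)), habs]
        exact pow_le_pow_left₀ (by positivity) h4 2
      have h6 : 1 / 2 ≤ 1 - Real.cos (⌊x⌋₊ * (δ * θ)) := by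
        refine le_trans ?_ h1
        calc (1 : ℝ) / 2 = 2 / Real.pi ^ 2 * (Real.pi / 2) ^ 2 := by field_simp
          _ ≤ _ := by gcongr
      have h2 := step1 _ hfN
      calc _ ≤ 1 / 8 * ((N : ℝ) * 1) := by
            gcongr
            · exact (min_le_right _ _).trans (min_le_right _ _)
            · exact min_le_left _ _
        _ = N * (1 / 2) / 4 := by ring
        _ ≤ N * (1 - Real.cos (⌊x⌋₊ * (δ * θ))) / 4 := by gcongr
        _ ≤ S := by linarith

variable {p : ℕ → Prop} [DecidablePred p]

theorem summable_one_sub_cos (h0 : ¬ p 0) {α : ℝ} (hα : 0 < α) (θ : ℝ) :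
    Summable fun i => wt p i * Real.exp (-α * sz i) * (1 - Real.cos (θ * sz i)) := by
  refine Summable.of_nonneg_of_le (fun i => ?_) (fun i => ?_)
    ((summable_wt_exp h0 hα).1.mul_right 2)
  · exact mul_nonneg (mul_nonneg (wt_nonneg i) (Real.exp_pos _).le) (one_sub_cos_nonneg _)
  · exact mul_le_mul_of_nonneg_left (by linarith [Real.neg_one_le_cos (θ * sz i)])
      (mul_nonneg (wt_nonneg i) (Real.exp_pos _).le)

/-- Only k = 1 and about 2/a² parts g + δj are kept. On these e^(-a²m) ≥ e^(-(g+4δ)), so the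
progression bound applies with N about 1/a². -/
theorem exists_decay_le {g δ : ℕ} (hδ : 0 < δ) (hg : Nat.Coprime g δ) (h0 : ¬ p 0)
    (hp : ∀ j, p (g + δ * j)) :
    ∃ c : ℝ, 0 < c ∧ ∀ a θ : ℝ, 0 < a → a ≤ 1 → |θ| ≤ Real.pi →
      decay c a θ ≤
        ∑' i, wt p i * Real.exp (-a ^ 2 * sz i) * (1 - Real.cos (θ * sz i)) := by
  obtain ⟨c, hc, hmain⟩ := exists_sum_one_sub_cos_ge hδ hg
  refine ⟨Real.exp (-(g + 4 * δ)) * c, by positivity, ?_⟩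
  intro a θ ha ha1 hθ
  have hα : 0 < a ^ 2 := by positivity
  have hα1 : a ^ 2 ≤ 1 := pow_le_one₀ ha.le ha1
  set N := ⌈1 / a ^ 2⌉₊ with hN
  have hN0 : 0 < N := Nat.ceil_pos.2 (by positivity)
  have hN1 : 1 / a ^ 2 ≤ N := Nat.le_ceil _
  have hN2 : (N : ℝ) < 1 / a ^ 2 + 1 := Nat.ceil_lt_add_one (by positivity)
  have hN3 : a ^ 2 * N ≤ 2 := by
    calc a ^ 2 * N ≤ a ^ 2 * (1 / a ^ 2 + 1) := by gcongr
      _ = 1 + a ^ 2 := by field_simp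
      _ ≤ 2 := by linarith
  have hinj : Function.Injective fun j : ℕ => ((1, g + δ * j) : ℕ × ℕ) := by
    intro i j hij
    have := (Prod.mk.inj hij).2
    have : δ * i = δ * j := by omega
    exact Nat.eq_of_mul_eq_mul_left hδ this
  have hs := summable_one_sub_cos h0 hα θ
  have h1 : ∑ j ∈ range (2 * N), wt p (1, g + δ * j) * Real.exp (-a ^ 2 * sz (1, g + δ * j)) *
      (1 - Real.cos (θ * sz (1, g + δ * j))) ≤
      ∑' i, wt p i * Real.exp (-a ^ 2 * sz i) * (1 - Real.cos (θ * sz i)) := by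
    have hmap := sum_map (range (2 * N)) ⟨fun j : ℕ => ((1, g + δ * j) : ℕ × ℕ), hinj⟩
      (fun i => wt p i * Real.exp (-a ^ 2 * sz i) * (1 - Real.cos (θ * sz i)))
    refine hmap.symm.trans_le ?_
    exact hs.sum_le_tsum _ fun i _ =>
      mul_nonneg (mul_nonneg (wt_nonneg i) (Real.exp_pos _).le) (one_sub_cos_nonneg _)
  have h2 : Real.exp (-(g + 4 * δ)) * ∑ j ∈ range (2 * N),
      (1 - Real.cos (((g + δ * j : ℕ) : ℝ) * θ)) ≤
      ∑ j ∈ range (2 * N), wt p (1, g + δ * j) * Real.exp (-a ^ 2 * sz (1, g + δ * j)) *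
      (1 - Real.cos (θ * sz (1, g + δ * j))) := by
    rw [mul_sum]
    refine sum_le_sum fun j hj => ?_
    have hw : wt p (1, g + δ * j) = 1 := by simp [wt, hp]
    have hz : sz (1, g + δ * j) = g + δ * j := one_mul _
    rw [hw, hz, one_mul, mul_comm θ]
    refine mul_le_mul_of_nonneg_right (Real.exp_le_exp.2 ?_) (one_sub_cos_nonneg _)
    have hj' : (j : ℝ) ≤ 2 * N := by exact_mod_cast (mem_range.1 hj).le
    have e1 : a ^ 2 * j ≤ 4 := by
      calc a ^ 2 * j ≤ a ^ 2 * (2 * N) := by gcongr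
        _ ≤ 4 := by linarith
    have e2 : (δ : ℝ) * (a ^ 2 * j) ≤ δ * 4 := by gcongr
    have e3 : a ^ 2 * g ≤ 1 * g := by gcongr
    push_cast
    linarith
  refine le_trans ?_ (h2.trans h1)
  have h3 := hmain N θ hN0 hθ
  rw [decay, mul_assoc]
  refine mul_le_mul_of_nonneg_left (le_trans ?_ h3) (Real.exp_pos _).le
  refine mul_le_mul_of_nonneg_left ?_ hc.le
  rw [mul_min_of_nonneg _ _ (Nat.cast_nonneg N), mul_one]
  refine min_le_min hN1 ?_
  calc (θ / a ^ 3) ^ 2 = (1 / a ^ 2) * ((1 / a ^ 2) * θ) ^ 2 := by field_simp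
    _ ≤ N * (N * θ) ^ 2 := by
      rw [mul_pow, mul_pow]
      gcongr

end MinorArcs

end PartitionAsymptotics

namespace PartitionAsymptotics

open Filter Topology Finset Benford

/-! ### Choice of the saddle point and local affinity of the logarithm -/

section Saddle

variable {p : ℕ → Prop} [DecidablePred p]

theorem one_sub_cos_le_self {x : ℝ} (hx : 0 ≤ x) : 1 - Real.cos x ≤ x := by
  rcases le_total x 2 with h | h
  · have := Real.one_sub_sq_div_two_le_cos (x := x)
    nlinarith
  · linarith [Real.neg_one_le_cos x]

/-- The decay bound at θ = a², where both entries of its minimum equal 1/a², combined with 1 - cos x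
≤ x. -/
theorem mean_ge {c a : ℝ} (h0 : ¬ p 0) (ha : 0 < a) (ha1 : a ≤ 1)
    (hlow : ∀ θ : ℝ, |θ| ≤ Real.pi → decay c a θ ≤
      ∑' i, wt p i * Real.exp (-a ^ 2 * sz i) * (1 - Real.cos (θ * sz i))) :
    c / a ^ 4 ≤ ∑' i, wt p i * Real.exp (-a ^ 2 * sz i) * sz i := by
  have hα : 0 < a ^ 2 := by positivity
  have hα1 : a ^ 2 ≤ 1 := pow_le_one₀ ha.le ha1
  have h1 := hlow (a ^ 2) (by rw [abs_of_pos hα]; linarith [Real.pi_gt_three])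
  have h2 : decay c a (a ^ 2) = c / a ^ 2 := by
    rw [decay, show (a ^ 2 / a ^ 3) ^ 2 = 1 / a ^ 2 by field_simp, min_self, mul_one_div]
  have hm := (summable_moment h0 1 hα).1
  simp only [pow_one] at hm
  have h3 : ∑' i, wt p i * Real.exp (-a ^ 2 * sz i) * (1 - Real.cos (a ^ 2 * sz i)) ≤
      ∑' i, wt p i * Real.exp (-a ^ 2 * sz i) * sz i * a ^ 2 := by
    refine (summable_one_sub_cos h0 hα _).tsum_le_tsum (fun i => ?_) (hm.mul_right _)
    rw [mul_assoc (wt p i * _), mul_comm (sz i : ℝ)]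
    exact mul_le_mul_of_nonneg_left (one_sub_cos_le_self (by positivity))
      (mul_nonneg (wt_nonneg i) (Real.exp_pos _).le)
  rw [tsum_mul_right] at h3
  rw [h2] at h1
  have h4 := h1.trans h3
  rw [div_le_iff₀ hα] at h4
  rw [div_le_iff₀ (by positivity)]
  linarith

theorem continuousOn_mean (h0 : ¬ p 0) {a₁ A : ℝ} (ha₁ : 0 < a₁) :
    ContinuousOn (fun a : ℝ => ∑' i, wt p i * Real.exp (-a ^ 2 * sz i) * sz i) (Set.Icc a₁ A) := by
  have hm := (summable_moment h0 1 (show 0 < a₁ ^ 2 by positivity)).1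
  simp only [pow_one] at hm
  refine continuousOn_tsum (fun i => by fun_prop) hm fun i a ha => ?_
  rw [Real.norm_of_nonneg (mul_nonneg (mul_nonneg (wt_nonneg i) (Real.exp_pos _).le)
    (Nat.cast_nonneg _))]
  have : a₁ ^ 2 ≤ a ^ 2 := pow_le_pow_left₀ ha₁.le ha.1 2
  have h2 := wt_nonneg (p := p) i
  gcongr

/-- Intermediate values between a = A, where the mean is at most N for N large, and a₁ ≤ c/N, where
it is at least c/a₁⁴ ≥ N. -/
theorem exists_saddle {c : ℝ} (hc : 0 < c) (h0 : ¬ p 0)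
    (hlow : ∀ a θ : ℝ, 0 < a → a ≤ 1 → |θ| ≤ Real.pi → decay c a θ ≤
      ∑' i, wt p i * Real.exp (-a ^ 2 * sz i) * (1 - Real.cos (θ * sz i)))
    {A : ℝ} (hA : 0 < A) (hA1 : A ≤ 1) :
    ∀ᶠ N : ℕ in atTop, ∃ a : ℝ, 0 < a ∧ a ≤ A ∧
      ∑' i, wt p i * Real.exp (-a ^ 2 * sz i) * sz i = N := by
  filter_upwards [eventually_gt_atTop 0,
    eventually_ge_atTop ⌈∑' i, wt p i * Real.exp (-A ^ 2 * sz i) * sz i⌉₊] with N hN hN2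
  have hN' : (0 : ℝ) < N := by exact_mod_cast hN
  set a₁ := min A (c / N) with ha₁
  have ha₁0 : 0 < a₁ := lt_min hA (by positivity)
  have ha₁A : a₁ ≤ A := min_le_left _ _
  have ha₁1 : a₁ ≤ 1 := ha₁A.trans hA1
  have h1 : (N : ℝ) ≤ ∑' i, wt p i * Real.exp (-a₁ ^ 2 * sz i) * sz i := by
    refine le_trans ?_ (mean_ge h0 ha₁0 ha₁1 fun θ hθ => hlow a₁ θ ha₁0 ha₁1 hθ)
    rw [le_div_iff₀ (by positivity)]
    have h2 : a₁ ^ 4 ≤ a₁ := by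
      calc a₁ ^ 4 ≤ a₁ ^ 1 := pow_le_pow_of_le_one ha₁0.le ha₁1 (by norm_num)
        _ = a₁ := pow_one _
    calc N * a₁ ^ 4 ≤ N * (c / N) := by
          gcongr
          exact h2.trans (min_le_right _ _)
      _ = c := by field_simp
  obtain ⟨a, ha, haN⟩ := intermediate_value_Icc' ha₁A (continuousOn_mean h0 ha₁0)
    ⟨Nat.ceil_le.1 hN2, h1⟩
  exact ⟨a, ha₁0.trans_le ha.1, ha.2, haN⟩

/-- The probability that the compound Poisson law at `α` attached to `p` assigns to `n`. -/
noncomputable def law (p : ℕ → Prop) [DecidablePred p] (α : ℝ) (n : ℕ) : ℝ :=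
  partsCount p n * Real.exp (-α * n) / Real.exp (∑' i, wt p i * Real.exp (-α * sz i))

/-- Dividing Cauchy's formula by the generating function at e^(-α) centres the exponent, giving the
form that `local_limit` expects. -/
theorem integral_law (h0 : ¬ p 0) {α : ℝ} (hα : 0 < α) (n : ℕ) :
    ∫ θ in (-Real.pi)..Real.pi,
      Complex.exp (∑' i, ((wt p i * Real.exp (-α * sz i) : ℝ) : ℂ) *
        (Complex.exp ((θ * sz i : ℝ) * Complex.I) - 1)) * Complex.exp (-(n * θ * Complex.I)) =
      ((2 * Real.pi * law p α n : ℝ) : ℂ) := by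
  set Z := ∑' i, wt p i * Real.exp (-α * sz i) with hZ
  have hs := (summable_wt_exp h0 hα).1
  have h1 : ∀ θ : ℝ, Complex.exp (∑' i, ((wt p i * Real.exp (-α * sz i) : ℝ) : ℂ) *
        (Complex.exp ((θ * sz i : ℝ) * Complex.I) - 1)) * Complex.exp (-(n * θ * Complex.I)) =
      Complex.exp (-Z) * (Complex.exp (∑' i, (wt p i : ℂ) * pt α θ ^ sz i) *
      Complex.exp (-(n * θ * Complex.I))) := by
    intro θ
    rw [← mul_assoc]
    congr 1
    rw [← Complex.exp_add]
    congr 1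
    have h2 := (summable_wt_pt h0 hα θ).hasSum.sub (Complex.hasSum_ofReal.2 hs.hasSum)
    rw [neg_add_eq_sub, ← h2.tsum_eq]
    refine tsum_congr fun i => ?_
    rw [pt_pow, show (θ * sz i : ℝ) * Complex.I = sz i * Complex.I * θ by push_cast; ring]
    push_cast
    ring
  simp_rw [h1]
  have hl : law p α n = partsCount p n * Real.exp (-α * n) / Real.exp Z := rfl
  rw [intervalIntegral.integral_const_mul, integral_partsCount h0 hα, hl, Complex.exp_neg,
    ← Complex.ofReal_exp]
  push_cast
  ring

theorem abs_log_le {x : ℝ} (hx : |x - 1| ≤ 1 / 2) : |Real.log x| ≤ 2 * |x - 1| := by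
  obtain ⟨h1, h2⟩ := abs_le.1 hx
  have hx0 : 0 < x := by linarith
  rw [abs_le]
  constructor
  · have h3 := Real.one_sub_inv_le_log_of_pos hx0
    have h4 : 1 - x⁻¹ = (x - 1) * x⁻¹ := by field_simp
    have h5 : x⁻¹ ≤ 2 := by
      rw [inv_le_comm₀ hx0 (by norm_num)]; linarith
    have h6 : 0 < x⁻¹ := by positivity
    rw [h4] at h3
    have h7 : -(|x - 1| * 2) ≤ (x - 1) * x⁻¹ := by
      have : |(x - 1) * x⁻¹| ≤ |x - 1| * 2 := by
        rw [abs_mul, abs_of_pos h6]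
        gcongr
      exact (abs_le.1 this).1
    linarith
  · have := Real.log_le_sub_one_of_pos hx0
    have := le_abs_self (x - 1)
    have := abs_nonneg (x - 1)
    linarith

/-- Restricted partition numbers are eventually positive, with locally affine logarithm. -/
theorem locallyAffine_log_partsCount {g δ : ℕ} (hδ : 0 < δ) (hg : Nat.Coprime g δ) (h0 : ¬ p 0)
    (hp : ∀ j, p (g + δ * j)) :
    (∀ᶠ n in atTop, partsCount p n ≠ 0) ∧ LocallyAffine fun n => Real.log (partsCount p n) := by
  obtain ⟨c, hc, hlow⟩ := exists_decay_le hδ hg h0 hp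
  set ζ : ℝ := ∑' k : ℕ, 1 / (k : ℝ) ^ 2 with hζ
  have hζ0 : 0 ≤ ζ := tsum_nonneg fun k => by positivity
  set C : ℝ := (Nat.factorial 2) * 2 ^ (2 + 1) * ζ + (Nat.factorial 3) * 2 ^ (3 + 1) * ζ + 1 with hC
  have hC0 : 0 < C := by positivity
  obtain ⟨a₀, D, ha₀, hD, hlim⟩ := local_limit hc hC0
  have main : ∀ A : ℝ, 0 < A → A ≤ 1 → A ≤ a₀ → ∀ᶠ N : ℕ in atTop, ∃ a : ℝ, 0 < a ∧ a ≤ A ∧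
      c / a ^ 4 ≤ N ∧ 0 < law p (a ^ 2) N ∧
      ∀ n : ℕ, |law p (a ^ 2) n / law p (a ^ 2) N - 1| ≤ D * |(n : ℝ) - N| * a ^ 3 := by
    intro A hA hA1 hA0
    filter_upwards [exists_saddle hc h0 hlow hA hA1] with N hN
    obtain ⟨a, ha, haA, hmean⟩ := hN
    have hα : 0 < a ^ 2 := by positivity
    have ha1 : a ≤ 1 := haA.trans hA1
    have hm1 := (summable_moment h0 1 hα).1
    simp only [pow_one] at hm1
    have hm2 := summable_moment h0 2 hα
    have hm3 := summable_moment h0 3 hα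
    have hlaw := hlim (fun i => wt p i * Real.exp (-a ^ 2 * sz i)) sz (law p (a ^ 2)) N a ha
      (haA.trans hA0) (fun i => mul_nonneg (wt_nonneg i) (Real.exp_pos _).le)
      (summable_wt_exp h0 hα).1 hm1 hm2.1 hm3.1 (integral_law h0 hα) hmean
      (fun θ hθ => hlow a θ ha ha1 hθ)
      (by
        refine hm2.2.trans ?_
        rw [← pow_mul]
        gcongr
        rw [hC, add_assoc]
        exact le_add_of_nonneg_right (by positivity))
      (by
        refine hm3.2.trans ?_
        rw [← pow_mul]
        gcongr
        rw [hC, add_right_comm]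
        exact le_add_of_nonneg_left (by positivity))
    refine ⟨a, ha, haA, ?_, hlaw⟩
    rw [← hmean]
    exact mean_ge h0 ha ha1 fun θ hθ => hlow a θ ha ha1 hθ
  have hpos : ∀ {α : ℝ} {n : ℕ}, 0 < law p α n → partsCount p n ≠ 0 := by
    intro α n h hn
    rw [law, hn] at h
    simp at h
  constructor
  · filter_upwards [main (min 1 a₀) (lt_min one_pos ha₀) (min_le_left _ _) (min_le_right _ _)]
      with N hN
    obtain ⟨a, -, -, -, h, -⟩ := hN
    exact hpos h
  · intro K ε hK hε
    set η := min (1 / 2) (ε / 2) with hη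
    have hη0 : 0 < η := lt_min (by norm_num) (by positivity)
    -- The bounds by ε and cε yield α ≤ ε and 1/α ≤ εN. The last entry makes the deviation D (K/a²)
    -- a³ = DKa at most η on the whole window.
    set A := min (min (min 1 a₀) (min ε (c * ε))) (η / (D * K)) with hA
    have hA0 : 0 < A :=
      lt_min (lt_min (lt_min one_pos ha₀) (lt_min hε (by positivity))) (by positivity)
    have hA1 : A ≤ min 1 a₀ := (min_le_left _ _).trans (min_le_left _ _)
    have hA2 : A ≤ min ε (c * ε) := (min_le_left _ _).trans (min_le_right _ _)
    filter_upwards [main A hA0 (hA1.trans (min_le_left _ _)) (hA1.trans (min_le_right _ _))]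
      with N hN
    obtain ⟨a, ha, haA, hcN, hlN, hratio⟩ := hN
    have ha1 : a ≤ 1 := haA.trans (hA1.trans (min_le_left _ _))
    have haa : a ^ 2 ≤ a := by nlinarith
    refine ⟨a ^ 2, by positivity, haa.trans (haA.trans (hA2.trans (min_le_left _ _))), ?_, ?_⟩
    · have h1 : a ^ 2 ≤ c * ε := haa.trans (haA.trans (hA2.trans (min_le_right _ _)))
      calc 1 / a ^ 2 = a ^ 2 / c * (c / a ^ 4) := by field_simp
        _ ≤ ε * N := by
          refine mul_le_mul ?_ hcN (by positivity) hε.le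
          rw [div_le_iff₀ hc]; linarith
    · intro m hm
      have h1 := hratio m
      have h2 : D * |(m : ℝ) - N| * a ^ 3 ≤ η := by
        have h3 : a ≤ η / (D * K) := haA.trans (min_le_right _ _)
        rw [le_div_iff₀ (by positivity)] at h3
        calc D * |(m : ℝ) - N| * a ^ 3 ≤ D * (K / a ^ 2) * a ^ 3 := by gcongr
          _ = a * (D * K) := by field_simp
          _ ≤ η := h3
      have h3 := h1.trans h2
      have h4 := abs_log_le (h3.trans (min_le_left _ _))
      have h5 : 0 < law p (a ^ 2) m / law p (a ^ 2) N := by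
        have h6 := (abs_le.1 (h3.trans (min_le_left _ _))).1
        linarith
      have hlm : 0 < law p (a ^ 2) m := by
        rw [div_pos_iff_of_pos_right hlN] at h5; exact h5
      have hm0 : (0 : ℝ) < partsCount p m := by exact_mod_cast Nat.pos_of_ne_zero (hpos hlm)
      have hN0 : (0 : ℝ) < partsCount p N := by exact_mod_cast Nat.pos_of_ne_zero (hpos hlN)
      -- The normalising factor cancels, and the tilt e^(-αn) becomes the linear term of slope α.
      have hlog : Real.log (law p (a ^ 2) m / law p (a ^ 2) N) =
          Real.log (partsCount p m) - Real.log (partsCount p N) - a ^ 2 * (m - N) := by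
        rw [Real.log_div hlm.ne' hlN.ne', law, law, Real.log_div (by positivity) (by positivity),
          Real.log_div (by positivity) (by positivity), Real.log_mul (by positivity) (by positivity),
          Real.log_mul (by positivity) (by positivity), Real.log_exp, Real.log_exp, Real.log_exp]
        ring
      rw [hlog] at h4
      refine h4.trans ?_
      have h6 : η ≤ ε / 2 := min_le_right _ _
      linarith

end Saddle

end PartitionAsymptotics

namespace PartitionAsymptotics

open Filter Topology Finset Benford

/-! ### Reduction to the coprime case and the nonzero terms -/

section Scaling

theorem partsCount_eq_zero {p : ℕ → Prop} [DecidablePred p] {e n : ℕ} (hp : ∀ i, p i → e ∣ i)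
    (hn : ¬ e ∣ n) : partsCount p n = 0 := by
  refine card_eq_zero.2 (eq_empty_of_forall_notMem fun x hx => hn ?_)
  simp only [Nat.Partition.restricted, mem_filter, mem_univ, true_and] at hx
  rw [← x.parts_sum]
  exact Multiset.dvd_sum fun i hi => hp i (hx i hi)

/-- Multiplying every part by e is a bijection between the two sets of partitions. -/
theorem partsCount_mul {p p' : ℕ → Prop} [DecidablePred p] [DecidablePred p'] {e : ℕ} (he : 0 < e)
    (hp : ∀ i, p i → e ∣ i) (hpp' : ∀ i, p (e * i) ↔ p' i) (m : ℕ) :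
    partsCount p (e * m) = partsCount p' m := by
  have hinj : Function.Injective fun i : ℕ => e * i := fun _ _ h =>
    Nat.eq_of_mul_eq_mul_left he h
  symm
  refine card_bij (fun x _ => ⟨x.parts.map (e * ·), ?_, ?_⟩) ?_ ?_ ?_
  · intro i hi
    obtain ⟨j, hj, rfl⟩ := Multiset.mem_map.1 hi
    exact Nat.mul_pos he (x.parts_pos hj)
  · rw [Multiset.sum_map_mul_left, Multiset.map_id', x.parts_sum]
  · intro x hx
    simp only [Nat.Partition.restricted, mem_filter, mem_univ, true_and] at hx ⊢
    intro i hi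
    obtain ⟨j, hj, rfl⟩ := Multiset.mem_map.1 hi
    exact (hpp' j).2 (hx j hj)
  · intro x _ y _ hxy
    exact Nat.Partition.ext (Multiset.map_injective hinj (congrArg Nat.Partition.parts hxy))
  · intro y hy
    simp only [Nat.Partition.restricted, mem_filter, mem_univ, true_and] at hy
    have hback : (y.parts.map (· / e)).map (e * ·) = y.parts := by
      rw [Multiset.map_map]
      conv_rhs => rw [← Multiset.map_id y.parts]
      exact Multiset.map_congr rfl fun i hi => Nat.mul_div_cancel' (hp i (hy i hi))
    refine ⟨⟨y.parts.map (· / e), ?_, ?_⟩, ?_, ?_⟩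
    · intro i hi
      obtain ⟨j, hj, rfl⟩ := Multiset.mem_map.1 hi
      exact Nat.div_pos (Nat.le_of_dvd (y.parts_pos hj) (hp j (hy j hj))) he
    · have h1 := congrArg Multiset.sum hback
      rw [Multiset.sum_map_mul_left, Multiset.map_id', y.parts_sum] at h1
      exact Nat.eq_of_mul_eq_mul_left he h1
    · simp only [Nat.Partition.restricted, mem_filter, mem_univ, true_and]
      intro i hi
      obtain ⟨j, hj, rfl⟩ := Multiset.mem_map.1 hi
      rw [← hpp', Nat.mul_div_cancel' (hp j (hy j hj))]
      exact hy j hj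
    · exact Nat.Partition.ext hback

end Scaling

/-- Beyond the last exception q enumerates consecutive integers; c is the number of exceptions below
n₀. -/
theorem exists_nth_eq_add {q : ℕ → Prop} (hq : ∀ᶠ n in atTop, q n) :
    ∃ c, ∀ᶠ j in atTop, Nat.nth q j = j + c := by
  classical
  obtain ⟨n₀, hn₀⟩ := eventually_atTop.1 hq
  have hle : Nat.count q n₀ ≤ n₀ := Nat.count_le q
  refine ⟨n₀ - Nat.count q n₀, ?_⟩
  have hcount : ∀ k, Nat.count q (n₀ + k) = Nat.count q n₀ + k := by
    intro k
    induction k with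
    | zero => rfl
    | succ k ih =>
      rw [← add_assoc, Nat.count_succ, ih, if_pos (hn₀ _ (Nat.le_add_right _ _)), add_assoc]
  filter_upwards [eventually_ge_atTop (Nat.count q n₀)] with j hj
  have h1 := Nat.nth_count (hn₀ (n₀ + (j - Nat.count q n₀)) (Nat.le_add_right _ _))
  rw [hcount, Nat.add_sub_cancel' hj] at h1
  rw [h1]
  omega

/-- The nonzero terms of a sequence that vanishes off the multiples of `e`. -/
theorem nonzeroTerms_eventuallyEq {a r : ℕ → ℕ} {e : ℕ} (he : 0 < e) (har : ∀ m, a (e * m) = r m)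
    (ha : ∀ n, a n ≠ 0 → e ∣ n) (hr : ∀ᶠ n in atTop, r n ≠ 0) :
    {n | a n ≠ 0}.Infinite ∧ ∃ c, ∀ᶠ j in atTop, nonzeroTerms a j = r (j + c) := by
  have hinj : Function.Injective fun i : ℕ => e * i := fun _ _ h =>
    Nat.eq_of_mul_eq_mul_left he h
  have hinf : {n | a n ≠ 0}.Infinite := by
    have h1 : {m | r m ≠ 0}.Infinite := Nat.frequently_atTop_iff_infinite.1 hr.frequently
    refine (h1.image hinj.injOn).mono ?_
    rintro _ ⟨m, hm, rfl⟩
    simpa [har] using hm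
  refine ⟨hinf, ?_⟩
  obtain ⟨c, hc⟩ := exists_nth_eq_add hr
  refine ⟨c, hc.mono fun j hj => ?_⟩
  have h1 := Nat.nth_comp_of_strictMono (p := fun n => a n ≠ 0) (n := j) (f := fun i => e * i)
    (fun x y hxy => Nat.mul_lt_mul_of_pos_left hxy he)
    (fun k hk => by obtain ⟨m, rfl⟩ := ha k hk; exact ⟨m, rfl⟩) (fun hfi => absurd hfi hinf)
  simp only [har] at h1
  rw [nonzeroTerms, ← h1, har, hj]

theorem modEq_mul_iff {e δ i : ℕ} (he : 0 < e) (z : ℤ) :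
    (((e * i : ℕ) : ℤ) ≡ (e : ℤ) * z [ZMOD ((e * δ : ℕ) : ℤ)]) ↔ (i : ℤ) ≡ z [ZMOD (δ : ℤ)] := by
  have he' : (e : ℤ) ≠ 0 := by exact_mod_cast he.ne'
  rw [Int.modEq_iff_dvd, Int.modEq_iff_dvd, Nat.cast_mul, Nat.cast_mul, ← mul_sub]
  exact mul_dvd_mul_iff_left he'

theorem isBenford_partitionCount {δ g : ℕ} (hg : 0 < g) (hgδ : 2 * g < δ) :
    {n : ℕ | partitionCount g δ n ≠ 0}.Infinite ∧
      IsBenford (nonzeroTerms (partitionCount g δ)) ∧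
      (Nat.Coprime g δ → IsBenford (partitionCount g δ)) := by
  have hcop : ∀ δ g : ℕ, 0 < g → g < δ → Nat.Coprime g δ →
      (∀ᶠ n in atTop, partitionCount g δ n ≠ 0) ∧
        LocallyAffine fun n => Real.log (partitionCount g δ n) := by
    intro δ g hg hgδ hc
    refine locallyAffine_log_partsCount (g := g) (δ := δ) (hg.trans hgδ) hc ?_ fun j => Or.inl ?_
    · have hnd : ¬ (δ : ℤ) ∣ g := by
        rw [Int.natCast_dvd_natCast]
        exact fun h => absurd (Nat.le_of_dvd hg h) (not_le.2 hgδ)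
      rintro (h | h)
      · rw [Int.modEq_iff_dvd] at h
        simp at h
        exact hnd (by exact_mod_cast h)
      · rw [Int.modEq_iff_dvd] at h
        simp at h
        exact hnd (by exact_mod_cast h)
    · rw [Int.modEq_iff_dvd]
      exact ⟨-j, by push_cast; ring⟩
  -- Admissible parts are multiples of e, so the counts vanish off multiples of e, and r_{g,δ}(em) =
  -- r_{g/e,δ/e}(m). The nonzero terms are eventually a shift of the coprime sequence.
  set e := Nat.gcd g δ with he
  have he0 : 0 < e := Nat.gcd_pos_of_pos_left _ hg
  obtain ⟨g', hg'⟩ : e ∣ g := Nat.gcd_dvd_left g δ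
  obtain ⟨δ', hδ'⟩ : e ∣ δ := Nat.gcd_dvd_right g δ
  have hc' : Nat.Coprime g' δ' := by
    have h1 : e * Nat.gcd g' δ' = e * 1 := by rw [← Nat.gcd_mul_left, ← hg', ← hδ', mul_one]
    exact Nat.eq_of_mul_eq_mul_left he0 h1
  have hg0 : 0 < g' := Nat.pos_of_ne_zero fun h => by rw [h, mul_zero] at hg'; omega
  have hlt : g' < δ' := by
    refine lt_of_mul_lt_mul_left (a := e) ?_ (Nat.zero_le _)
    rw [← hg', ← hδ']; omega
  obtain ⟨hne, hloc⟩ := hcop δ' g' hg0 hlt hc'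
  have hdvd : ∀ i : ℕ, ((i : ℤ) ≡ (g : ℤ) [ZMOD (δ : ℤ)] ∨ (i : ℤ) ≡ -(g : ℤ) [ZMOD (δ : ℤ)]) →
      e ∣ i := by
    intro i hi
    have h1 : (e : ℤ) ∣ g := by rw [hg']; exact ⟨g', by push_cast; ring⟩
    have h2 : (e : ℤ) ∣ δ := by rw [hδ']; exact ⟨δ', by push_cast; ring⟩
    have h3 : (e : ℤ) ∣ i := by
      rcases hi with hi | hi
      · rw [Int.modEq_iff_dvd] at hi
        exact (dvd_sub_right h1).1 (h2.trans hi)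
      · rw [Int.modEq_iff_dvd] at hi
        exact (dvd_sub_right ((dvd_neg).2 h1)).1 (h2.trans hi)
    exact_mod_cast h3
  have hmul : ∀ m, partitionCount g δ (e * m) = partitionCount g' δ' m := by
    intro m
    refine partsCount_mul he0 hdvd (fun i => ?_) m
    rw [hg', hδ']
    refine or_congr ?_ ?_
    · rw [Nat.cast_mul e g']; exact modEq_mul_iff he0 _
    · rw [Nat.cast_mul e g', ← mul_neg]; exact modEq_mul_iff he0 _
  have hzero : ∀ n, partitionCount g δ n ≠ 0 → e ∣ n := by
    intro n hn
    by_contra h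
    exact hn (partsCount_eq_zero hdvd h)
  obtain ⟨hinf, c, hshift⟩ := nonzeroTerms_eventuallyEq he0 hmul hzero hne
  refine ⟨hinf, ?_, fun hc => ?_⟩
  · refine isBenford_of_locallyAffine ?_ ((hloc.comp_add c).congr ?_)
    · filter_upwards [hshift, (tendsto_add_atTop_nat c).eventually hne] with j hj hj2
      rwa [hj]
    · filter_upwards [hshift] with j hj
      rw [hj]
  · obtain ⟨h1, h2⟩ := hcop δ g hg (by omega) hc
    exact isBenford_of_locallyAffine h1 h2

end PartitionAsymptotics

theorem corollary1p5 :
    (∀ δ g : ℕ, 2 ≤ δ → 0 < g → g < (δ + 1) / 2 →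
      {n : ℕ | partitionCount g δ n ≠ 0}.Infinite ∧
      IsBenford (nonzeroTerms (partitionCount g δ)) ∧
      (Nat.Coprime g δ → IsBenford (partitionCount g δ))) ∧
    (∀ a : ℕ, a = 0 ∨ a = 1 →
      HasSum
        (fun n : ℕ => (PowerSeries.X : PowerSeries ℚ) ^ (n ^ 2 + a * n) *
          (qPochhammer (PowerSeries.X : PowerSeries ℚ) PowerSeries.X n)⁻¹)
        (PowerSeries.mk fun n => (partitionCount (a + 1) 5 n : ℚ)) ∧
      HasProd
        (fun n : ℕ => ((1 - (PowerSeries.X : PowerSeries ℚ) ^ (5 * n + a + 1)) *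
          (1 - (PowerSeries.X : PowerSeries ℚ) ^ (5 * n + 4 - a)))⁻¹)
        (PowerSeries.mk fun n => (partitionCount (a + 1) 5 n : ℚ))) := by
  refine ⟨fun δ g _ hg hgδ => PartitionAsymptotics.isBenford_partitionCount hg (by omega),
    fun a ha => ⟨RogersRamanujan.hasSum_rogersRamanujan ha,
      RogersRamanujan.hasProd_partitionCount_five ha⟩⟩
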